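/- Let $\lambda,c,t>0$ and let $N$ be a homogeneous Poisson process of rate $\lambda$ with event times $0=t_0<t_1<t_2<\cdots$. A particle starts at the origin of $\mathbb{R}^3$ and moves at constant speed $c$; its initial direction, and the new direction it takes at each even-indexed event $t_2,t_4,\dots$, are independent, uniformly distributed on the unit sphere and independent of $N$. Let $U(t)=(U_1(t),U_2(t),U_3(t))$ be its position at time $t$. (a) For every $n\ge 1$, conditionally on $N(t)=2n+1$, $U(t)$ has density $$\frac{\Gamma(n+\frac32)}{\pi^{3/2}\,\Gamma(n)\,(ct)^{2n+1}}\,(c^2t^2-\|u\|^2)^{n-1},\qquad \|u\|<ct$$ (and $0$ elsewhere). For $d=3$ this coincides with $$p_{X_d}(x,t;n)=\frac{\Gamma(\frac{n+1}{2}(d-1)+\frac12)}{\Gamma(\frac n2(d-1))}\,\frac{(c^2t^2-\|x\|^2)^{\frac n2(d-1)-1}}{\pi^{d/2}(ct)^{(n+1)(d-1)-1}},\qquad \|x\|<ct,$$ and it is the law of the random flight $X_3(t)=c\sum_{j=1}^{n+1}\tau_jD_j$ with $n$ changes of direction, where $D_1,\dots,D_{n+1}$ are independent and uniform on the unit sphere,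 and $(\tau_1,\dots,\tau_n)$ is independent of them with the Dirichlet density (for $d=3$) $$\frac{\Gamma((n+1)(d-1))}{\Gamma(d-1)^{n+1}}\,\frac{1}{t^{(n+1)(d-1)-1}}\prod_{j=1}^{n+1}\tau_j^{d-2},\qquad \tau_1,\dots,\tau_{n+1}>0,\quad \tau_{n+1}=t-\sum_{j=1}^n\tau_j .$$ (b) Let $T$ be the telegraph process with speed $c$ and rate $\lambda$: $T(t)=cV\int_0^t(-1)^{N(s)}\,ds$, where $V=\pm1$ with probability $\frac12$ each, independently of the Poisson process $N$ of rate $\lambda$. When the number of Poisson events is odd, the projection $U_1(t)$ has the same law as $T(t)$: for every $n\ge 0$, conditionally on $N(t)=2n+1$, both $U_1(t)$ and $T(t)$ have density $$\frac{(2n+1)!}{(n!)^2}\,\frac{(c^2t^2-x^2)^n}{(2ct)^{2n+1}},\qquad |x|<ct,$$ and on the event that $N(t)$ is odd $$P\{U_1(t)\in dx,\ N(t)\text{ odd}\}=P\{T(t)\in dx,\ N(t)\text{ odd}\}=e^{-\lambda t}\,\frac{\lambda}{2c}\,I_0\!\left(\frac{\lambda}{c}\sqrt{c^2t^2-x^2}\right)dx,\qquad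 |x|<ct,$$ where $I_0(z)=\sum_{k\ge0}(z/2)^{2k}/(k!)^2$. -/

import Mathlib

open MeasureTheory ProbabilityTheory
open scoped ENNReal

noncomputable section

namespace RandomFlight

/-- The uniform probability distribution on the unit sphere of `ℝ^d` (normalized surface
measure), as a measure on `ℝ^d`. -/
def uniformSphere (d : ℕ) : Measure (EuclideanSpace ℝ (Fin d)) :=
  (((volume : Measure (EuclideanSpace ℝ (Fin d))).toSphere Set.univ)⁻¹ •
    (volume : Measure (EuclideanSpace ℝ (Fin d))).toSphere).map Subtype.val

/-! ### The homogeneous Poisson process -/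

/-- `S 0, S 1, …` are the waiting times between consecutive events of a homogeneous Poisson
process of rate `r`: independent, exponentially distributed with parameter `r`. -/
structure IsPoissonGaps {Ω : Type*} [MeasurableSpace Ω] (P : Measure Ω) (r : ℝ)
    (S : ℕ → Ω → ℝ) : Prop where
  law : ∀ k, HasLaw (S k) (expMeasure r) P
  indep : iIndepFun S P

/-- The instant `t_k` at which the `k`-th event happens, with `t_0 = 0`. -/
def eventTime {Ω : Type*} (S : ℕ → Ω → ℝ) (k : ℕ) (ω : Ω) : ℝ :=
  ∑ i ∈ Finset.range k, S i ω

/-- `N(t)`: the number of events `k ≥ 1` with `t_k ≤ t`. -/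
def eventCount {Ω : Type*} (S : ℕ → Ω → ℝ) (t : ℝ) (ω : Ω) : ℕ :=
  Set.ncard {k : ℕ | 1 ≤ k ∧ eventTime S k ω ≤ t}

/-! ### The three-dimensional flight turning at the even Poisson events -/

/-- The random ingredients of the flight: the gaps `S` of a homogeneous Poisson process of
rate `r`, and independent uniformly distributed directions `D 0, D 1, …`, where `D k` is
chosen at the instant `t_{2k}`; gaps and directions are independent. -/
structure IsEvenFlight {Ω : Type*} [MeasurableSpace Ω] (P : Measure Ω) (r : ℝ)
    (S : ℕ → Ω → ℝ) (D : ℕ → Ω → EuclideanSpace ℝ (Fin 3)) : Prop where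
  gaps : IsPoissonGaps P r S
  law_dir : ∀ k, HasLaw (D k) (uniformSphere 3) P
  indep_dir : iIndepFun D P
  indep : IndepFun (fun ω k => S k ω) (fun ω k => D k ω) P

/-- The position `U(t)` of the particle which starts at the origin, moves at speed `c` and
follows the direction `D k` from `t_{2k}` until `t_{2k+2}` (or until `t`, if that is earlier). -/
def evenFlight {Ω : Type*} (c : ℝ) (S : ℕ → Ω → ℝ) (D : ℕ → Ω → EuclideanSpace ℝ (Fin 3))
    (t : ℝ) (ω : Ω) : EuclideanSpace ℝ (Fin 3) :=
  c • ∑ k ∈ Finset.range (eventCount S t ω / 2 + 1),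
    (min (eventTime S (2 * k + 2) ω) t - eventTime S (2 * k) ω) • D k ω

/-! ### The telegraph process -/

/-- The random ingredients of the telegraph process: the gaps `S` of a homogeneous Poisson
process of rate `r` and an independent symmetric initial sign `V`. -/
structure IsTelegraph {Ω : Type*} [MeasurableSpace Ω] (P : Measure Ω) (r : ℝ)
    (S : ℕ → Ω → ℝ) (V : Ω → ℝ) : Prop where
  gaps : IsPoissonGaps P r S
  law_sign : HasLaw V
    ((2 : ℝ≥0∞)⁻¹ • Measure.dirac (1 : ℝ) + (2 : ℝ≥0∞)⁻¹ • Measure.dirac (-1 : ℝ)) P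
  indep : IndepFun V (fun ω k => S k ω) P

/-- The telegraph process `T(t)`: a particle on the line starts at `0` with velocity `c V`, and
its velocity is reversed at every Poisson event. -/
def telegraph {Ω : Type*} (c : ℝ) (S : ℕ → Ω → ℝ) (V : Ω → ℝ) (t : ℝ) (ω : Ω) : ℝ :=
  c * V ω * ∑ k ∈ Finset.range (eventCount S t ω + 1),
    (-1) ^ k * (min (eventTime S (k + 1) ω) t - eventTime S k ω)

/-! ### The flight in `ℝ^d` with Dirichlet distributed displacements -/

/-- All `n + 1` step durations of a flight, given the first `n` of them:
the last one is `t - τ_1 - ⋯ - τ_n`. -/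
def allSteps {n : ℕ} (t : ℝ) (τ : Fin n → ℝ) : Fin (n + 1) → ℝ :=
  Fin.snoc (α := fun _ => ℝ) τ (t - ∑ i, τ i)

open scoped Classical in
/-- The rescaled Dirichlet density with parameters `(d - 1, …, d - 1)` of `(τ_1, …, τ_n)`. -/
def dirichletDensity (d n : ℕ) (t : ℝ) (τ : Fin n → ℝ) : ℝ :=
  if ∀ j, 0 < allSteps t τ j then
    Real.Gamma (((n : ℝ) + 1) * ((d : ℝ) - 1)) / Real.Gamma ((d : ℝ) - 1) ^ (n + 1)
      * (1 / t ^ (((n : ℝ) + 1) * ((d : ℝ) - 1) - 1))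
      * ∏ j, allSteps t τ j ^ ((d : ℝ) - 2)
  else 0

/-- The law at time `t` of the random flight `X_d` in `ℝ^d` with speed `c` and `n` changes of
direction: the durations of the steps have the Dirichlet density above, the `n + 1` directions
are independent and uniform on the sphere, and durations and directions are independent. -/
def dirichletFlightLaw (d n : ℕ) (c t : ℝ) : Measure (EuclideanSpace ℝ (Fin d)) :=
  (((volume : Measure (Fin n → ℝ)).withDensity
      (fun τ => ENNReal.ofReal (dirichletDensity d n t τ))).prod
    (Measure.pi (fun _ : Fin (n + 1) => uniformSphere d))).map
    (fun p => c • ∑ j, allSteps t p.1 j • p.2 j)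

open scoped Classical in
/-- The function `p_{X_d}(x, t; n)`. -/
def dirichletFlightDensity (d n : ℕ) (c t : ℝ) (x : EuclideanSpace ℝ (Fin d)) : ℝ :=
  if ‖x‖ < c * t then
    Real.Gamma (((n : ℝ) + 1) / 2 * ((d : ℝ) - 1) + 1 / 2)
        / Real.Gamma ((n : ℝ) / 2 * ((d : ℝ) - 1))
      * ((c ^ 2 * t ^ 2 - ‖x‖ ^ 2) ^ ((n : ℝ) / 2 * ((d : ℝ) - 1) - 1)
        / (Real.pi ^ ((d : ℝ) / 2) * (c * t) ^ (((n : ℝ) + 1) * ((d : ℝ) - 1) - 1)))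
  else 0

/-! ### The densities of the result -/

open scoped Classical in
/-- `Γ(n+3/2) / (π^{3/2} Γ(n) (ct)^{2n+1}) · (c²t² - ‖u‖²)^{n-1}` on `‖u‖ < ct`
(only used for `n ≥ 1`). -/
def evenFlightDensity (n : ℕ) (c t : ℝ) (u : EuclideanSpace ℝ (Fin 3)) : ℝ :=
  if ‖u‖ < c * t then
    Real.Gamma ((n : ℝ) + 3 / 2)
        / (Real.pi ^ (3 / 2 : ℝ) * Real.Gamma n * (c * t) ^ (2 * n + 1))
      * (c ^ 2 * t ^ 2 - ‖u‖ ^ 2) ^ (n - 1)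
  else 0

open scoped Classical in
/-- `(2n+1)! / (n!)² · (c²t² - x²)^n / (2ct)^{2n+1}` on `|x| < ct`. -/
def lineDensity (n : ℕ) (c t x : ℝ) : ℝ :=
  if |x| < c * t then
    ((2 * n + 1).factorial : ℝ) / (n.factorial : ℝ) ^ 2
      * ((c ^ 2 * t ^ 2 - x ^ 2) ^ n / (2 * c * t) ^ (2 * n + 1))
  else 0

/-- The modified Bessel function `I₀`. -/
def besselI0 (x : ℝ) : ℝ := ∑' k : ℕ, (x / 2) ^ (2 * k) / (k.factorial : ℝ) ^ 2

open scoped Classical in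
/-- `e^{-rt} (r / 2c) I₀((r / c) √(c²t² - x²))` on `|x| < ct`. -/
def oddLineDensity (r c t x : ℝ) : ℝ :=
  if |x| < c * t then
    Real.exp (-(r * t)) * (r / (2 * c))
      * besselI0 (r / c * Real.sqrt (c ^ 2 * t ^ 2 - x ^ 2))
  else 0

end RandomFlight

end

/-!
The number of Poisson events up to time `t` is `2n+1` exactly when `t_{2n+1} ≤ t < t_{2n+2}` (up to
a null event). On this event everything is a function of finitely many independent exponential gaps,
and all laws are obtained by integrating out gaps one at a time; no geometry of simplices is needed.

*Telegraph process.* The position is `c V (2A - t)`, where `A` is the sum of the `n+1` gaps of even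
index. It has a Gamma distribution and is independent of the odd gaps, whose number of renewals in
the remaining time `t - A` has to be `n`. Hence `A` has a density proportional to `a^n (t-a)^n` on
`(0, t)` (`lintegral_window_even_sum`), which is `lineDensity` after an affine substitution
(`hasLaw_alternating`, `hasLaw_telegraph`).

*Even flight.* The complete steps are sums of two gaps, hence independent `Gamma(2)` variables. The
last, incomplete step of duration `R` has the weight `r R e^{-rR}`, and the product of the densities
is the Dirichlet density (`dirichletLaw_eq_withDensity`, `hasLaw_evenFlight`).

*First coordinate.* By Archimedes' theorem (`map_coord_uniformSphere`) the first coordinate of a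
uniform direction is uniform on `(-1, 1)`. On the other hand, given the sum `τ = s + s'` of two
independent exponential gaps, the difference `s - s'` is uniform on `(-τ, τ)`
(`map_sum_sub_expMeasure_prod`). So a step of duration `τ` in a random direction moves the first
coordinate just as a forward gap `s` and a backward gap `s'` would, and the projection of the even
flight has the law of the telegraph process (`map_coord_dirichletFlightLaw`).

*Position in space.* A finite measure on `ℝ³` which is invariant under linear isometries is
determined by its image under the first coordinate, since its characteristic function is radial
(`eq_of_map_coord_eq`). Integrating `evenFlightDensity` over discs gives `lineDensity`
(`map_coord_evenFlightDensity`), so it is the density of the position.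

Summing the densities over all `n` with their Poisson weights gives the series of `I₀`
(`sum_smul_lineLaw`).
-/

namespace RandomFlight

/-! ### Poisson waiting times -/

section

lemma lintegral_comp_affine {a : ℝ} (ha : a ≠ 0) (b : ℝ) {f : ℝ → ℝ≥0∞} (hf : Measurable f) :
    ∫⁻ x, f (a * x + b) = ENNReal.ofReal |a⁻¹| * ∫⁻ x, f x := by
  have h1 : ∫⁻ x, f (a * x + b) = ∫⁻ y, f (y + b) ∂((volume : Measure ℝ).map (a * ·)) := by
    rw [lintegral_map (by fun_prop) (by fun_prop)]
  rw [h1, Real.map_volume_mul_left ha, lintegral_smul_measure, lintegral_add_right_eq_self f b,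
    smul_eq_mul]

lemma lintegral_Ioo_pow (m : ℕ) {x : ℝ} (hx : 0 ≤ x) :
    ∫⁻ y in Set.Ioo 0 x, ENNReal.ofReal (y ^ m) = ENNReal.ofReal (x ^ (m + 1) / (m + 1)) := by
  rw [← ofReal_integral_eq_lintegral_ofReal, ← integral_Ioc_eq_integral_Ioo,
    ← intervalIntegral.integral_of_le hx, integral_pow]
  · simp
  · exact ((continuous_pow m).integrableOn_Icc).mono_set Set.Ioo_subset_Icc_self
  · filter_upwards [ae_restrict_mem measurableSet_Ioo] with y hy
    exact pow_nonneg hy.1.le m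

/-- The Gamma distribution with a positive integer as shape parameter (the Erlang distribution),
without `Real.Gamma` and real powers. -/
lemma lintegral_gammaMeasure_natCast {r : ℝ} (m : ℕ) {f : ℝ → ℝ≥0∞} (hf : Measurable f) :
    ∫⁻ x, f x ∂(gammaMeasure (m + 1) r) = ∫⁻ x in Set.Ioi 0,
      ENNReal.ofReal (r ^ (m + 1) * x ^ m / m.factorial * Real.exp (-(r * x))) * f x := by
  rw [gammaMeasure, lintegral_withDensity_eq_lintegral_mul _
    (by exact (measurable_gammaPDFReal _ _).ennreal_ofReal) hf,
    ← lintegral_indicator measurableSet_Ioi]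
  refine lintegral_congr_ae ?_
  filter_upwards [Measure.ae_ne volume (0 : ℝ)] with x hx
  rcases lt_or_gt_of_ne hx with h | h
  · simp [gammaPDF_of_neg h, h.le]
  · rw [Set.indicator_of_mem (Set.mem_Ioi.2 h), Pi.mul_apply, gammaPDF_of_nonneg h.le]
    congr 2
    rw [Real.Gamma_nat_eq_factorial, add_sub_cancel_right, Real.rpow_natCast,
      ← Nat.cast_add_one, Real.rpow_natCast]
    ring

lemma lintegral_expMeasure {r : ℝ} {f : ℝ → ℝ≥0∞} (hf : Measurable f) :
    ∫⁻ x, f x ∂(expMeasure r) = ∫⁻ x in Set.Ioi 0,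
      ENNReal.ofReal (r * Real.exp (-(r * x))) * f x := by
  have := lintegral_gammaMeasure_natCast (r := r) 0 hf
  simpa [expMeasure] using this

lemma expMeasure_Ioi {r : ℝ} (hr : 0 < r) {y : ℝ} (hy : 0 ≤ y) :
    expMeasure r (Set.Ioi y) = ENNReal.ofReal (Real.exp (-(r * y))) := by
  have := isProbabilityMeasure_expMeasure hr
  have h := cdf_expMeasure_eq hr y
  rw [cdf_eq_real, if_pos hy] at h
  rw [← Set.compl_Iic, ← ofReal_measureReal, probReal_compl_eq_one_sub measurableSet_Iic, h]
  congr 1; ring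

/-- The shear `(x, y) ↦ (x, x + y)` maps the quadrant onto the cone `0 < x < z`. -/
lemma lintegral_Ioi_Ioi_add {F : ℝ → ℝ → ℝ≥0∞} (hF : Measurable (Function.uncurry F)) :
    ∫⁻ x in Set.Ioi 0, ∫⁻ y in Set.Ioi 0, F x (x + y)
      = ∫⁻ z in Set.Ioi (0 : ℝ), ∫⁻ x in Set.Ioo 0 z, F x z := by
  have h1 : ∀ x, ∫⁻ y in Set.Ioi 0, F x (x + y) = ∫⁻ z in Set.Ioi x, F x z := by
    intro x
    rw [← lintegral_indicator measurableSet_Ioi, ← lintegral_indicator measurableSet_Ioi,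
      ← lintegral_add_left_eq_self ((Set.Ioi x).indicator (F x)) x]
    congr with y
    simp [Set.indicator]
  simp_rw [h1, ← lintegral_indicator measurableSet_Ioi, ← lintegral_indicator measurableSet_Ioo]
  have hm : Measurable (fun p : ℝ × ℝ => {p : ℝ × ℝ | 0 < p.1 ∧ p.1 < p.2}.indicator
      (Function.uncurry F) p) :=
    hF.indicator ((measurableSet_lt measurable_const measurable_fst).inter
      (measurableSet_lt measurable_fst measurable_snd))
  have h2 : ∀ x, (Set.Ioi (0 : ℝ)).indicator (fun x => ∫⁻ z, (Set.Ioi x).indicator (F x) z) x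
      = ∫⁻ z, {p : ℝ × ℝ | 0 < p.1 ∧ p.1 < p.2}.indicator (Function.uncurry F) (x, z) := by
    intro x
    by_cases hx : 0 < x <;> simp [Set.indicator, hx]
  have h3 : ∀ z, (Set.Ioi (0 : ℝ)).indicator (fun z => ∫⁻ x, (Set.Ioo 0 z).indicator (F · z) x) z
      = ∫⁻ x, {p : ℝ × ℝ | 0 < p.1 ∧ p.1 < p.2}.indicator (Function.uncurry F) (x, z) := by
    intro z
    by_cases hz : 0 < z
    · rw [Set.indicator_of_mem (by exact hz)]
      exact lintegral_congr fun x => by simp [Set.indicator]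
    · rw [Set.indicator_of_notMem (by simpa using hz)]
      symm
      rw [lintegral_eq_zero_iff (by exact hm.comp (by fun_prop))]
      refine .of_forall fun x => Set.indicator_of_notMem ?_ _
      rintro ⟨h, h'⟩
      exact hz (h.trans h')
  simp_rw [h2, h3]
  exact lintegral_lintegral_swap (f := fun x z => {p : ℝ × ℝ | 0 < p.1 ∧ p.1 < p.2}.indicator
    (Function.uncurry F) (x, z)) hm.aemeasurable

/-- Adding an independent exponential waiting time raises the shape of a Gamma distribution by one:
both exponentials combine to `e^{-rz}`, and `∫_0^z x^m dx` is left. -/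
lemma gammaMeasure_conv_expMeasure {r : ℝ} (hr : 0 < r) (m : ℕ) :
    (gammaMeasure (m + 1) r) ∗ (expMeasure r) = gammaMeasure ((m + 1 : ℕ) + 1) r := by
  have := isProbabilityMeasure_expMeasure hr
  refine Measure.ext_of_lintegral _ fun f hf => ?_
  have hm : Measurable fun x => ∫⁻ y, f (x + y) ∂(expMeasure r) :=
    Measurable.lintegral_prod_right' (f := fun p : ℝ × ℝ => f (p.1 + p.2)) (by fun_prop)
  rw [Measure.lintegral_conv hf, lintegral_gammaMeasure_natCast _ hf,
    lintegral_gammaMeasure_natCast _ hm]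
  have h1 : ∀ x, ENNReal.ofReal (r ^ (m + 1) * x ^ m / m.factorial * Real.exp (-(r * x))) *
      ∫⁻ y, f (x + y) ∂(expMeasure r) = ∫⁻ y in Set.Ioi 0,
        ENNReal.ofReal (r ^ (m + 1) * x ^ m / m.factorial * Real.exp (-(r * x))) *
        (ENNReal.ofReal (r * Real.exp (-(r * (x + y - x)))) * f (x + y)) := by
    intro x
    rw [lintegral_expMeasure (by fun_prop), lintegral_const_mul _ (by fun_prop)]
    simp
  simp_rw [h1]
  rw [lintegral_Ioi_Ioi_add (F := fun x z => ENNReal.ofReal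
    (r ^ (m + 1) * x ^ m / m.factorial * Real.exp (-(r * x))) *
        (ENNReal.ofReal (r * Real.exp (-(r * (z - x)))) * f z)) (by fun_prop)]
  refine setLIntegral_congr_fun measurableSet_Ioi fun z hz => ?_
  have hz' : 0 < z := hz
  have h2 : ∀ x ∈ Set.Ioo 0 z, ENNReal.ofReal
      (r ^ (m + 1) * x ^ m / m.factorial * Real.exp (-(r * x))) *
        (ENNReal.ofReal (r * Real.exp (-(r * (z - x)))) * f z) =
      ENNReal.ofReal (x ^ m) *
        (ENNReal.ofReal (r ^ (m + 2) / m.factorial * Real.exp (-(r * z))) * f z) := by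
    intro x hx
    have hx' := hx.1
    rw [← mul_assoc, ← mul_assoc, ← ENNReal.ofReal_mul (by positivity),
      ← ENNReal.ofReal_mul (by positivity)]
    congr 2
    have : Real.exp (-(r * z)) = Real.exp (-(r * x)) * Real.exp (-(r * (z - x))) := by
      rw [← Real.exp_add]; congr 1; ring
    rw [this]; ring
  rw [setLIntegral_congr_fun measurableSet_Ioo h2, lintegral_mul_const _ (by fun_prop),
    lintegral_Ioo_pow _ hz'.le, ← mul_assoc, ← ENNReal.ofReal_mul (by positivity)]
  congr 2
  rw [Nat.factorial_succ]; push_cast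
  field_simp

variable {Ω : Type*} [MeasurableSpace Ω] {P : Measure Ω} {r : ℝ}

lemma hasLaw_sum_gamma [IsProbabilityMeasure P] (hr : 0 < r) {X : ℕ → Ω → ℝ}
    (hX : IsPoissonGaps P r X) (m : ℕ) :
    HasLaw (fun ω => ∑ i ∈ Finset.range (m + 1), X i ω) (gammaMeasure (m + 1) r) P := by
  have := isProbabilityMeasure_expMeasure hr
  induction m with
  | zero => simpa [expMeasure] using hX.law 0
  | succ m ih =>
    have := isProbabilityMeasure_gammaMeasure (a := m + 1) (by positivity) hr
    have h := (hX.indep.indepFun_sum_range_succ₀ (fun i => (hX.law i).aemeasurable) (m + 1))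
    have e : (∑ j ∈ Finset.range (m + 1), X j) = fun ω => ∑ i ∈ Finset.range (m + 1), X i ω := by
      ext ω; simp
    rw [e] at h
    have := h.hasLaw_fun_add ih (hX.law (m + 1))
    rw [gammaMeasure_conv_expMeasure hr] at this
    simpa [Finset.sum_range_succ _ (m + 1)] using this

lemma indepFun_sum_next {X : ℕ → Ω → ℝ} (hX : IsPoissonGaps P r X) (m : ℕ) :
    IndepFun (fun ω => ∑ i ∈ Finset.range m, X i ω) (X m) P := by
  have h := (hX.indep.indepFun_sum_range_succ₀ (fun i => (hX.law i).aemeasurable) m)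
  have e : (∑ j ∈ Finset.range m, X j) = fun ω => ∑ i ∈ Finset.range m, X i ω := by
    ext ω; simp
  rwa [e] at h

/-- The number of events in `[0, u]` has the Poisson distribution with parameter `r u`. -/
lemma measure_sum_window [IsProbabilityMeasure P] (hr : 0 < r) {X : ℕ → Ω → ℝ}
    (hX : IsPoissonGaps P r X) (m : ℕ) {u : ℝ} (hu : 0 ≤ u) :
    P {ω | ∑ i ∈ Finset.range m, X i ω ≤ u ∧ u < ∑ i ∈ Finset.range (m + 1), X i ω}
      = ENNReal.ofReal (Real.exp (-(r * u)) * (r * u) ^ m / m.factorial) := by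
  have := isProbabilityMeasure_expMeasure hr
  cases m with
  | zero =>
    have := (hX.law 0).measure_eq (p := fun x => x ∈ Set.Ioi u) (by exact measurableSet_Ioi)
    simp only [Set.ofPred_mem_eq] at this
    rw [expMeasure_Ioi hr hu] at this
    simpa [hu] using this
  | succ m =>
    have := isProbabilityMeasure_gammaMeasure (a := m + 1) (by positivity) hr
    have h := (indepFun_iff_hasLaw_prodMk_prod (hasLaw_sum_gamma hr hX m) (hX.law (m + 1))).1
      (indepFun_sum_next hX (m + 1))
    have hs : MeasurableSet {p : ℝ × ℝ | p.1 ≤ u ∧ u < p.1 + p.2} :=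
      (measurableSet_le measurable_fst measurable_const).inter
        (measurableSet_lt measurable_const (measurable_fst.add measurable_snd))
    have h' := h.measure_eq hs
    simp only [Finset.sum_range_succ _ (m + 1)]
    rw [h', Measure.prod_apply hs]
    have hmeas := measurable_measure_prodMk_left (ν := expMeasure r) hs
    rw [lintegral_gammaMeasure_natCast _ hmeas]
    have h2 : ∀ x ∈ Set.Ioi (0:ℝ),
        ENNReal.ofReal (r ^ (m + 1) * x ^ m / m.factorial * Real.exp (-(r * x))) *
        expMeasure r (Prod.mk x ⁻¹' {p : ℝ × ℝ | p.1 ≤ u ∧ u < p.1 + p.2}) =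
        (Set.Iic u).indicator (fun x => ENNReal.ofReal (x ^ m) *
          ENNReal.ofReal (r ^ (m + 1) / m.factorial * Real.exp (-(r * u)))) x := by
      intro x hx
      have hx' : 0 < x := hx
      by_cases hxu : x ≤ u
      · have : Prod.mk x ⁻¹' {p : ℝ × ℝ | p.1 ≤ u ∧ u < p.1 + p.2} = Set.Ioi (u - x) := by
          ext y; simp [hxu, sub_lt_iff_lt_add']
        rw [this, expMeasure_Ioi hr (by linarith), Set.indicator_of_mem (by exact hxu),
          ← ENNReal.ofReal_mul (by positivity), ← ENNReal.ofReal_mul (by positivity)]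
        congr 1
        have : Real.exp (-(r * u)) = Real.exp (-(r * x)) * Real.exp (-(r * (u - x))) := by
          rw [← Real.exp_add]; congr 1; ring
        rw [this]; ring
      · have : Prod.mk x ⁻¹' {p : ℝ × ℝ | p.1 ≤ u ∧ u < p.1 + p.2} = ∅ := by
          ext y; simp [hxu]
        rw [this, Set.indicator_of_notMem (by exact hxu)]; simp
    rw [setLIntegral_congr_fun measurableSet_Ioi h2, setLIntegral_indicator measurableSet_Iic,
      Set.inter_comm, Set.Ioi_inter_Iic, ← restrict_Ioo_eq_restrict_Ioc,
      lintegral_mul_const _ (by fun_prop), lintegral_Ioo_pow _ hu,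
      ← ENNReal.ofReal_mul (by positivity)]
    congr 1
    rw [Nat.factorial_succ]; push_cast
    field_simp
    ring

end

/-! ### The event of a given number of Poisson events -/

section

variable {Ω : Type*} [MeasurableSpace Ω] {P : Measure Ω} {r : ℝ}

/-- A version of `HasLaw.lintegral_comp` on an event that depends only on the random variable. The
variable is merely a.e.-measurable, so the event need not be measurable. -/
lemma setLIntegral_comp_of_hasLaw {E : Type*} [MeasurableSpace E] {Z : Ω → E} {ρ : Measure E}
    (hZ : HasLaw Z ρ P) {B : Set E} (hB : MeasurableSet B) {f : E → ℝ≥0∞} (hf : Measurable f) :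
    ∫⁻ ω in Z ⁻¹' B, f (Z ω) ∂P = ∫⁻ z in B, f z ∂ρ := by
  rw [← hZ.map_eq, Measure.restrict_map_of_aemeasurable hZ.aemeasurable hB,
    lintegral_map' hf.aemeasurable hZ.aemeasurable.restrict]

lemma ae_gaps_pos (hr : 0 < r) {S : ℕ → Ω → ℝ} (hS : IsPoissonGaps P r S) :
    ∀ᵐ ω ∂P, ∀ k, 0 < S k ω := by
  have := isProbabilityMeasure_expMeasure hr
  rw [ae_all_iff]
  intro k
  have h0 : ∀ᵐ x ∂(expMeasure r), 0 < x := by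
    have : expMeasure r (Set.Ioi 0) = 1 := by simpa using expMeasure_Ioi hr le_rfl
    exact (mem_ae_iff_prob_eq_one measurableSet_Ioi).2 this
  exact ((hS.law k).ae_iff (p := fun x => 0 < x)
    (measurableSet_setOfPred.1 measurableSet_Ioi)).2 h0

lemma eventTime_strictMono {Ω : Type*} {S : ℕ → Ω → ℝ} {ω : Ω} (h : ∀ k, 0 < S k ω) :
    StrictMono fun k => eventTime S k ω :=
  strictMono_nat_of_lt_succ fun k => by
    simpa [eventTime, Finset.sum_range_succ] using h k

lemma eventCount_eq_of_window {Ω : Type*} {S : ℕ → Ω → ℝ} {ω : Ω} (h : ∀ k, 0 < S k ω) {t : ℝ} {m : ℕ}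
    (h1 : eventTime S m ω ≤ t) (h2 : t < eventTime S (m + 1) ω) : eventCount S t ω = m := by
  have hmono := eventTime_strictMono h
  have : {k : ℕ | 1 ≤ k ∧ eventTime S k ω ≤ t} = ↑(Finset.Icc 1 m) := by
    ext k
    simp only [Set.mem_ofPred_eq, Finset.coe_Icc, Set.mem_Icc, and_congr_right_iff]
    intro _
    constructor
    · intro hk
      by_contra hlt
      exact (hk.trans_lt h2).not_ge (hmono.monotone (by omega : m + 1 ≤ k))
    · intro hk
      exact (hmono.monotone hk).trans h1
  rw [eventCount, this, Set.ncard_coe_finset]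
  simp

/-- The case `m = 0` is excluded because `eventCount` has the junk value `0` if all events happen up
to time `t`. -/
lemma window_of_eventCount_eq {Ω : Type*} {S : ℕ → Ω → ℝ} {ω : Ω} (h : ∀ k, 0 < S k ω) {t : ℝ} (ht : 0 ≤ t)
    {m : ℕ} (hm : m ≠ 0) (hc : eventCount S t ω = m) :
    eventTime S m ω ≤ t ∧ t < eventTime S (m + 1) ω := by
  classical
  have hex : ∃ k, t < eventTime S k ω := by
    by_contra! hall
    have : {k : ℕ | 1 ≤ k ∧ eventTime S k ω ≤ t} = Set.Ici 1 := by
      ext k; simp [hall]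
    rw [eventCount, this, (Set.Ici_infinite 1).ncard] at hc
    exact hm hc.symm
  obtain ⟨M, hM⟩ : ∃ M, Nat.find hex = M + 1 := by
    refine Nat.exists_eq_succ_of_ne_zero fun h0 => ?_
    have := Nat.find_spec hex
    rw [h0] at this
    simp [eventTime] at this
    linarith
  have h1 : eventTime S M ω ≤ t := not_lt.1 (Nat.find_min hex (by omega))
  have h2 : t < eventTime S (M + 1) ω := hM ▸ Nat.find_spec hex
  have : M = m := (eventCount_eq_of_window h h1 h2).symm.trans hc
  exact this ▸ ⟨h1, h2⟩

/-- The event that exactly `m` Poisson events happen up to time `t`, written in terms of the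
event times. -/
def window {Ω : Type*} (S : ℕ → Ω → ℝ) (t : ℝ) (m : ℕ) : Set Ω :=
  {ω | eventTime S m ω ≤ t ∧ t < eventTime S (m + 1) ω}

lemma eventCount_ae_eq_window (hr : 0 < r) {S : ℕ → Ω → ℝ} (hS : IsPoissonGaps P r S) {t : ℝ}
    (ht : 0 ≤ t) {m : ℕ} (hm : m ≠ 0) :
    {ω | eventCount S t ω = m} =ᵐ[P] window S t m := by
  filter_upwards [ae_gaps_pos hr hS] with ω hω
  exact propext ⟨window_of_eventCount_eq hω ht hm, fun h => eventCount_eq_of_window hω h.1 h.2⟩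

lemma aemeasurable_eventTime {S : ℕ → Ω → ℝ} (hS : IsPoissonGaps P r S) (k : ℕ) :
    AEMeasurable (eventTime S k) P :=
  Finset.aemeasurable_fun_sum _ fun i _ => (hS.law i).aemeasurable

lemma nullMeasurableSet_window {S : ℕ → Ω → ℝ} (hS : IsPoissonGaps P r S) (t : ℝ) (m : ℕ) :
    NullMeasurableSet (window S t m) P :=
  (nullMeasurableSet_le (aemeasurable_eventTime hS m) aemeasurable_const).inter
    (nullMeasurableSet_lt aemeasurable_const (aemeasurable_eventTime hS (m + 1)))

lemma measure_window [IsProbabilityMeasure P] (hr : 0 < r) {S : ℕ → Ω → ℝ}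
    (hS : IsPoissonGaps P r S) (m : ℕ) {t : ℝ} (ht : 0 ≤ t) :
    P (window S t m) = ENNReal.ofReal (Real.exp (-(r * t)) * (r * t) ^ m / m.factorial) :=
  measure_sum_window hr hS m ht

/-- The gaps at the even indices and those at the odd indices are independent. -/
lemma indepFun_even_odd {S : ℕ → Ω → ℝ} (hS : IsPoissonGaps P r S) (m : ℕ) :
    IndepFun (fun ω (k : Fin m) => S (2 * k) ω) (fun ω (k : Fin m) => S (2 * k + 1) ω) P := by
  classical
  set T₁ := (Finset.range m).image (2 * ·)
  set T₂ := (Finset.range m).image (2 * · + 1)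
  have hd : Disjoint T₁ T₂ := by
    simp only [Finset.disjoint_left, T₁, T₂, Finset.mem_image, not_exists, not_and]
    rintro _ ⟨a, -, rfl⟩ b - h
    omega
  have h := hS.indep.indepFun_finset₀ T₁ T₂ hd fun i => (hS.law i).aemeasurable
  exact h.comp
    (φ := fun x (k : Fin m) => x ⟨2 * k, Finset.mem_image_of_mem _ (Finset.mem_range.2 k.2)⟩)
    (ψ := fun x (k : Fin m) => x ⟨2 * k + 1,
      Finset.mem_image_of_mem (2 * · + 1) (Finset.mem_range.2 k.2)⟩)
    (measurable_pi_lambda _ fun k => measurable_pi_apply _)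
    (measurable_pi_lambda _ fun k => measurable_pi_apply _)

lemma IsPoissonGaps.precomp {S : ℕ → Ω → ℝ} (hS : IsPoissonGaps P r S) {g : ℕ → ℕ}
    (hg : Function.Injective g) : IsPoissonGaps P r fun k => S (g k) :=
  ⟨fun k => hS.law (g k), hS.indep.precomp hg⟩

lemma eventTime_two_mul {Ω : Type*} (S : ℕ → Ω → ℝ) (n : ℕ) (ω : Ω) :
    eventTime S (2 * n) ω = ∑ k ∈ Finset.range n, S (2 * k) ω
      + ∑ k ∈ Finset.range n, S (2 * k + 1) ω := by
  induction n with
  | zero => simp [eventTime]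
  | succ n ih =>
    rw [eventTime] at ih ⊢
    rw [show 2 * (n + 1) = 2 * n + 1 + 1 by ring, Finset.sum_range_succ, Finset.sum_range_succ, ih,
      Finset.sum_range_succ, Finset.sum_range_succ]
    ring

lemma eventTime_two_mul_add_one {Ω : Type*} (S : ℕ → Ω → ℝ) (n : ℕ) (ω : Ω) :
    eventTime S (2 * n + 1) ω = ∑ k ∈ Finset.range (n + 1), S (2 * k) ω
      + ∑ k ∈ Finset.range n, S (2 * k + 1) ω := by
  have := eventTime_two_mul S n ω
  rw [eventTime] at this ⊢
  rw [Finset.sum_range_succ, this, Finset.sum_range_succ]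
  ring

/-- On the event that there are exactly `2n+1` Poisson events, the time `A` spent in the initial
direction is the sum of the `n+1` gaps of even index. It has the `Gamma(n+1)` distribution and is
independent of the odd gaps, which have to satisfy `B_n ≤ t - A < B_{n+1}`; the probability of this
is a Poisson weight with parameter `r (t - A)`. -/
lemma lintegral_window_even_sum [IsProbabilityMeasure P] (hr : 0 < r) {S : ℕ → Ω → ℝ}
    (hS : IsPoissonGaps P r S) (t : ℝ) (n : ℕ) {f : ℝ → ℝ≥0∞} (hf : Measurable f) :
    ∫⁻ ω in window S t (2 * n + 1), f (∑ k ∈ Finset.range (n + 1), S (2 * k) ω) ∂P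
      = ∫⁻ a in Set.Ioo 0 t, ENNReal.ofReal
        (r ^ (2 * n + 1) * Real.exp (-(r * t)) * (a ^ n * (t - a) ^ n) / (n.factorial) ^ 2) *
          f a := by
  set A : Ω → ℝ := fun ω => ∑ k ∈ Finset.range (n + 1), S (2 * k) ω with hA
  set B : ℕ → Ω → ℝ := fun m ω => ∑ k ∈ Finset.range m, S (2 * k + 1) ω with hB
  have hX : IsPoissonGaps P r fun k => S (2 * k) := hS.precomp fun a b h => by simpa using h
  have hY : IsPoissonGaps P r fun k => S (2 * k + 1) := hS.precomp fun a b h => by simpa using h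
  have hind : IndepFun A (fun ω => (B n ω, B (n + 1) ω)) P := by
    have := (indepFun_even_odd hS (n + 1)).comp (φ := fun x => ∑ k, x k)
      (ψ := fun x => (∑ k : Fin n, x k.castSucc, ∑ k, x k)) (by fun_prop) (by fun_prop)
    convert this using 1
    · ext ω; simp [hA, Finset.sum_range]
    · ext ω <;> simp [hB, Finset.sum_range]
  have hAlaw : HasLaw A (gammaMeasure (n + 1) r) P := hasLaw_sum_gamma hr hX n
  have hBm : ∀ m, AEMeasurable (B m) P := fun m => aemeasurable_eventTime hY m
  have hBB : AEMeasurable (fun ω => (B n ω, B (n + 1) ω)) P := (hBm _).prodMk (hBm _)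
  have hBlaw : HasLaw (fun ω => (B n ω, B (n + 1) ω))
    (P.map fun ω => (B n ω, B (n + 1) ω)) P := ⟨hBB, rfl⟩
  set ν := P.map fun ω => (B n ω, B (n + 1) ω) with hν
  have := isProbabilityMeasure_gammaMeasure (a := n + 1) (by positivity) hr
  have : IsProbabilityMeasure ν := Measure.isProbabilityMeasure_map hBB
  have hlaw := (indepFun_iff_hasLaw_prodMk_prod hAlaw hBlaw).1 hind
  have hs : MeasurableSet {p : ℝ × ℝ × ℝ | p.1 + p.2.1 ≤ t ∧ t < p.1 + p.2.2} :=
    (measurableSet_le (f := fun p : ℝ × ℝ × ℝ => p.1 + p.2.1) (by fun_prop) measurable_const).inter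
      (measurableSet_lt (g := fun p : ℝ × ℝ × ℝ => p.1 + p.2.2) measurable_const (by fun_prop))
  have hwin : window S t (2 * n + 1) = (fun ω => (A ω, B n ω, B (n + 1) ω)) ⁻¹'
      {p : ℝ × ℝ × ℝ | p.1 + p.2.1 ≤ t ∧ t < p.1 + p.2.2} := by
    ext ω
    have h2 := eventTime_two_mul S (n + 1) ω
    rw [show 2 * (n + 1) = 2 * n + 1 + 1 by ring] at h2
    simp [window, h2, eventTime_two_mul_add_one, hA, hB]
  rw [hwin, setLIntegral_comp_of_hasLaw hlaw hs (f := fun p => f p.1) (by fun_prop),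
    ← lintegral_indicator hs, lintegral_prod _ (by fun_prop)]
  have hin : ∀ a, ∫⁻ b, {p : ℝ × ℝ × ℝ | p.1 + p.2.1 ≤ t ∧ t < p.1 + p.2.2}.indicator
      (fun p => f p.1) (a, b) ∂ν = f a * ν (Prod.mk a ⁻¹'
        {p : ℝ × ℝ × ℝ | p.1 + p.2.1 ≤ t ∧ t < p.1 + p.2.2}) := by
    intro a
    rw [← lintegral_indicator_const (measurable_prodMk_left hs)]
    rfl
  simp_rw [hin]
  -- for `a > t` the window is empty, since sums of gaps are almost surely nonnegative
  have hpos : ∀ᵐ ω ∂P, 0 ≤ B n ω := by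
    filter_upwards [ae_gaps_pos hr hS] with ω hω
    exact Finset.sum_nonneg fun i _ => (hω _).le
  have hval : ∀ a, ν (Prod.mk a ⁻¹' {p : ℝ × ℝ × ℝ | p.1 + p.2.1 ≤ t ∧ t < p.1 + p.2.2})
      = (Set.Iic t).indicator (fun a => ENNReal.ofReal
        (Real.exp (-(r * (t - a))) * (r * (t - a)) ^ n / n.factorial)) a := by
    intro a
    rw [hν, Measure.map_apply_of_aemeasurable hBB (measurable_prodMk_left hs)]
    have e : (fun ω => (B n ω, B (n + 1) ω)) ⁻¹'
        (Prod.mk a ⁻¹' {p : ℝ × ℝ × ℝ | p.1 + p.2.1 ≤ t ∧ t < p.1 + p.2.2})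
        = {ω | B n ω ≤ t - a ∧ t - a < B (n + 1) ω} := by
      ext ω
      simp [le_sub_iff_add_le', sub_lt_iff_lt_add']
    rw [e]
    by_cases ha : a ≤ t
    · rw [Set.indicator_of_mem (by exact ha)]
      exact measure_sum_window hr hY n (by linarith)
    · rw [Set.indicator_of_notMem (by exact ha)]
      refine measure_eq_zero_iff_ae_notMem.2 ?_
      filter_upwards [hpos] with ω hω h
      exact ha (by linarith [h.1])
  have hm : Measurable fun a => f a * ν (Prod.mk a ⁻¹'
        {p : ℝ × ℝ × ℝ | p.1 + p.2.1 ≤ t ∧ t < p.1 + p.2.2}) :=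
    hf.mul (measurable_measure_prodMk_left hs)
  rw [lintegral_gammaMeasure_natCast _ hm]
  simp_rw [hval]
  rw [restrict_Ioo_eq_restrict_Ioc, ← Set.Ioi_inter_Iic, Set.inter_comm,
    ← setLIntegral_indicator measurableSet_Iic]
  refine setLIntegral_congr_fun measurableSet_Ioi fun a ha => ?_
  have ha' : 0 < a := ha
  by_cases hat : a ≤ t
  · have : 0 ≤ t - a := by linarith
    simp only [Set.indicator_of_mem (show a ∈ Set.Iic t from hat)]
    rw [mul_comm (f a), ← mul_assoc, ← ENNReal.ofReal_mul (by positivity)]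
    congr 2
    have : Real.exp (-(r * t)) = Real.exp (-(r * a)) * Real.exp (-(r * (t - a))) := by
      rw [← Real.exp_add]; congr 1; ring
    rw [this, mul_pow]; ring
  · simp [hat]

/-- The alternating sum of `S_0, …, S_{2n}` is twice the sum over the even indices minus the sum of
all of them. -/
lemma alternating_sum_eq {Ω : Type*} (S : ℕ → Ω → ℝ) (n : ℕ) (ω : Ω) :
    ∑ k ∈ Finset.range (2 * n + 1), (-1) ^ k * S k ω
      = 2 * ∑ k ∈ Finset.range (n + 1), S (2 * k) ω - eventTime S (2 * n + 1) ω := by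
  induction n with
  | zero => simp [eventTime]; ring
  | succ n ih =>
    rw [show 2 * (n + 1) + 1 = 2 * n + 1 + 1 + 1 by ring, eventTime] at *
    rw [Finset.sum_range_succ, Finset.sum_range_succ, ih, Finset.sum_range_succ _ (n + 1),
      Finset.sum_range_succ _ (2 * n + 2), Finset.sum_range_succ _ (2 * n + 1)]
    simp [pow_succ, pow_mul]
    rw [show 2 * (n + 1) = 2 * n + 1 + 1 by ring]
    ring

/-- On the event of exactly `2n+1` changes of velocity, the telegraph process is at
`c V (2A - t)`, where `A` is the total time spent with the initial velocity. -/
lemma telegraph_eq_of_window {Ω : Type*} {S : ℕ → Ω → ℝ} {ω : Ω} (h : ∀ k, 0 < S k ω) {t : ℝ} {n : ℕ}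
    (hw : ω ∈ window S t (2 * n + 1)) (c : ℝ) (V : Ω → ℝ) :
    telegraph c S V t ω = V ω * (c * (2 * ∑ k ∈ Finset.range (n + 1), S (2 * k) ω - t)) := by
  have hmono := eventTime_strictMono h
  rw [telegraph, eventCount_eq_of_window h hw.1 hw.2, Finset.sum_range_succ, min_eq_right hw.2.le]
  have : ∀ k ∈ Finset.range (2 * n + 1),
      (-1 : ℝ) ^ k * (min (eventTime S (k + 1) ω) t - eventTime S k ω) = (-1) ^ k * S k ω := by
    intro k hk
    rw [min_eq_left ((hmono.monotone (Finset.mem_range.1 hk)).trans hw.1)]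
    simp [eventTime, Finset.sum_range_succ]
  rw [Finset.sum_congr rfl this, alternating_sum_eq]
  simp [pow_succ, pow_mul]
  ring

end

/-! ### The telegraph process -/

section

variable {Ω : Type*} [MeasurableSpace Ω] {P : Measure Ω} {r : ℝ}

lemma measurable_lineDensity (n : ℕ) (c t : ℝ) : Measurable (lineDensity n c t) := by
  unfold lineDensity
  refine Measurable.ite (measurableSet_lt (by fun_prop) measurable_const) (by fun_prop)
    measurable_const

lemma lineDensity_neg (n : ℕ) (c t x : ℝ) : lineDensity n c t (-x) = lineDensity n c t x := by
  simp [lineDensity]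

/-- The law with density `lineDensity n c t`. -/
noncomputable def lineLaw (n : ℕ) (c t : ℝ) : Measure ℝ :=
  volume.withDensity fun x => ENNReal.ofReal (lineDensity n c t x)

lemma lintegral_lineLaw (n : ℕ) (c t : ℝ) {f : ℝ → ℝ≥0∞} (hf : Measurable f) :
    ∫⁻ x, f x ∂(lineLaw n c t) = ∫⁻ x, ENNReal.ofReal (lineDensity n c t x) * f x :=
  lintegral_withDensity_eq_lintegral_mul _ (measurable_lineDensity n c t).ennreal_ofReal hf

lemma lintegral_lineLaw_neg (n : ℕ) (c t : ℝ) {f : ℝ → ℝ≥0∞} (hf : Measurable f) :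
    ∫⁻ x, f (-x) ∂(lineLaw n c t) = ∫⁻ x, f x ∂(lineLaw n c t) := by
  rw [lintegral_lineLaw _ _ _ hf, lintegral_lineLaw _ _ _ (by fun_prop),
    ← lintegral_neg_eq_self]
  simp [lineDensity_neg]

/-- If `A` has the density proportional to `a^n (t-a)^n` on `(0, t)`, then `c (2A - t)` has the
density `lineDensity n c t`. -/
lemma lintegral_lineLaw_eq (n : ℕ) {c t : ℝ} (hc : 0 < c) (ht : 0 < t) {f : ℝ → ℝ≥0∞}
    (hf : Measurable f) :
    ∫⁻ x, f x ∂(lineLaw n c t) = ∫⁻ a in Set.Ioo 0 t, ENNReal.ofReal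
      ((2 * n + 1).factorial / t ^ (2 * n + 1) * (a ^ n * (t - a) ^ n) / (n.factorial) ^ 2) *
        f (c * (2 * a - t)) := by
  have h := lintegral_comp_affine (a := 2 * c) (by positivity) (-(c * t))
    (f := fun x => ENNReal.ofReal (lineDensity n c t x) * f x)
    ((measurable_lineDensity n c t).ennreal_ofReal.mul hf)
  have h' : ∫⁻ x, ENNReal.ofReal (lineDensity n c t x) * f x = ENNReal.ofReal (2 * c) *
      ∫⁻ a, ENNReal.ofReal (lineDensity n c t (2 * c * a + -(c * t))) *
        f (2 * c * a + -(c * t)) := by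
    rw [h, ← mul_assoc, ← ENNReal.ofReal_mul (by positivity), abs_of_pos (by positivity),
      mul_inv_cancel₀ (by positivity)]
    simp
  rw [lintegral_lineLaw _ _ _ hf, h', ← lintegral_const_mul' _ _ ENNReal.ofReal_ne_top,
    ← lintegral_indicator measurableSet_Ioo]
  refine lintegral_congr fun a => ?_
  have hiff : |2 * c * a + -(c * t)| < c * t ↔ a ∈ Set.Ioo 0 t := by
    rw [abs_lt, Set.mem_Ioo]
    constructor
    · rintro ⟨h1, h2⟩
      constructor
      · by_contra! h; nlinarith
      · by_contra! h; nlinarith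
    · rintro ⟨h1, h2⟩
      constructor <;> nlinarith
  by_cases ha : a ∈ Set.Ioo 0 t
  · rw [Set.indicator_of_mem ha, lineDensity, if_pos (hiff.2 ha), ← mul_assoc,
      ← ENNReal.ofReal_mul (by positivity)]
    congr 2
    · have : c ^ 2 * t ^ 2 - (2 * c * a + -(c * t)) ^ 2 = (2 * c) ^ 2 * (a * (t - a)) := by ring
      rw [this, mul_pow, ← pow_mul, mul_pow (2 * c) t, pow_succ (2 * c), mul_pow a]
      field_simp
    · ring
  · rw [Set.indicator_of_notMem ha, lineDensity, if_neg (fun h => ha (hiff.1 h))]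
    simp

/-- The position at time `t` of a particle on the line which starts with velocity `c` and reverses
its velocity at each of exactly `2n+1` Poisson events. -/
lemma hasLaw_alternating [IsProbabilityMeasure P] (hr : 0 < r) {S : ℕ → Ω → ℝ}
    (hS : IsPoissonGaps P r S) {c t : ℝ} (hc : 0 < c) (ht : 0 < t) (n : ℕ) :
    HasLaw (fun ω => c * (2 * ∑ k ∈ Finset.range (n + 1), S (2 * k) ω - t))
      (P (window S t (2 * n + 1)) • lineLaw n c t) (P.restrict (window S t (2 * n + 1))) := by
  have hm : AEMeasurable (fun ω => c * (2 * ∑ k ∈ Finset.range (n + 1), S (2 * k) ω - t)) P :=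
    (((Finset.aemeasurable_fun_sum _ fun i _ =>
      (hS.law (2 * i)).aemeasurable).const_mul 2).sub_const t).const_mul c
  refine ⟨hm.restrict, Measure.ext_of_lintegral _ fun f hf => ?_⟩
  rw [lintegral_map' hf.aemeasurable hm.restrict, lintegral_smul_measure, smul_eq_mul,
    lintegral_window_even_sum hr hS t n (f := fun a => f (c * (2 * a - t))) (by fun_prop),
    lintegral_lineLaw_eq n hc ht hf, measure_window hr hS _ ht.le,
    ← lintegral_const_mul' _ _ ENNReal.ofReal_ne_top]
  refine setLIntegral_congr_fun measurableSet_Ioo fun a ha => ?_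
  rw [← mul_assoc (ENNReal.ofReal _), ← ENNReal.ofReal_mul (by positivity)]
  congr 2
  rw [mul_pow]
  field_simp

/-- Laws on the event `W` are stated without normalization, as `P W • μ` for the restricted measure:
this form passes to the conditional law as well as to unions of events. -/
lemma hasLaw_cond_of_restrict {E : Type*} [MeasurableSpace E] {X : Ω → E} {μ : Measure E}
    [IsFiniteMeasure P] {A W : Set Ω} (hAW : A =ᵐ[P] W) (h0 : P W ≠ 0)
    (h : HasLaw X (P W • μ) (P.restrict W)) : HasLaw X μ (ProbabilityTheory.cond P A) := by
  have e : ProbabilityTheory.cond P A = (P W)⁻¹ • P.restrict W := by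
    rw [ProbabilityTheory.cond, measure_congr hAW, Measure.restrict_congr_set hAW]
  rw [e]
  refine ⟨h.aemeasurable.smul_measure _, ?_⟩
  rw [Measure.map_smul, h.map_eq, smul_smul, ENNReal.inv_mul_cancel h0 (measure_ne_top P W),
    one_smul]

lemma measure_window_ne_zero [IsProbabilityMeasure P] (hr : 0 < r) {S : ℕ → Ω → ℝ}
    (hS : IsPoissonGaps P r S) (m : ℕ) {t : ℝ} (ht : 0 < t) : P (window S t m) ≠ 0 := by
  rw [measure_window hr hS m ht.le, Ne, ENNReal.ofReal_eq_zero, not_le]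
  positivity

/-- Adding the weighted densities over all odd numbers of events produces the Bessel function. -/
lemma sum_smul_lineLaw {c t : ℝ} (hr : 0 < r) (hc : 0 < c) (ht : 0 < t) :
    Measure.sum (fun n : ℕ => ENNReal.ofReal
      (Real.exp (-(r * t)) * (r * t) ^ (2 * n + 1) / (2 * n + 1).factorial) • lineLaw n c t)
      = volume.withDensity fun x => ENNReal.ofReal (oddLineDensity r c t x) := by
  have hm := fun n => (measurable_lineDensity n c t).ennreal_ofReal
  simp_rw [lineLaw, ← withDensity_smul _ (hm _)]
  rw [← withDensity_tsum fun n => (hm n).const_smul _]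
  congr 1
  ext x
  rw [tsum_apply (by exact Pi.summable.2 fun _ => ENNReal.summable)]
  simp only [Pi.smul_apply, smul_eq_mul]
  by_cases hx : |x| < c * t
  · have hsq : 0 ≤ c ^ 2 * t ^ 2 - x ^ 2 := by
      have : x ^ 2 ≤ (c * t) ^ 2 := sq_le_sq.2 (hx.le.trans (le_abs_self _))
      nlinarith
    set z := r / c * Real.sqrt (c ^ 2 * t ^ 2 - x ^ 2) with hz
    have hterm : ∀ n : ℕ, ENNReal.ofReal
        (Real.exp (-(r * t)) * (r * t) ^ (2 * n + 1) / (2 * n + 1).factorial) *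
        ENNReal.ofReal (lineDensity n c t x) = ENNReal.ofReal
        (Real.exp (-(r * t)) * (r / (2 * c)) * ((z / 2) ^ (2 * n) / (n.factorial : ℝ) ^ 2)) := by
      intro n
      rw [← ENNReal.ofReal_mul (by positivity), lineDensity, if_pos hx]
      congr 1
      have : (z / 2) ^ (2 * n) = (r / (2 * c)) ^ (2 * n) * (c ^ 2 * t ^ 2 - x ^ 2) ^ n := by
        rw [pow_mul, pow_mul, ← mul_pow, hz, div_pow, mul_pow, Real.sq_sqrt hsq]
        congr 1
        field_simp
      rw [this, div_pow, pow_succ (2 * c * t), mul_pow (2 * c), pow_succ (r * t), mul_pow r]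
      field_simp
    -- compare with the exponential series of `(z / 2) ^ 2`
    have hsum : Summable fun n : ℕ => (z / 2) ^ (2 * n) / (n.factorial : ℝ) ^ 2 := by
      refine Summable.of_nonneg_of_le (fun n => ?_) (fun n => ?_)
        (Real.summable_pow_div_factorial ((z / 2) ^ 2))
      · rw [pow_mul]; positivity
      · rw [pow_mul]
        have : (1 : ℝ) ≤ n.factorial := by exact_mod_cast n.factorial_pos
        gcongr
        nlinarith
    simp_rw [hterm]
    rw [← ENNReal.ofReal_tsum_of_nonneg (fun n => by rw [pow_mul]; positivity)
      (hsum.mul_left _), tsum_mul_left, oddLineDensity, if_pos hx, besselI0]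
  · simp [lineDensity, oddLineDensity, hx]

lemma pairwise_disjoint_window {S : ℕ → Ω → ℝ} (hr : 0 < r) (hS : IsPoissonGaps P r S) (t : ℝ) :
    Pairwise fun i j : ℕ => AEDisjoint P (window S t (2 * i + 1)) (window S t (2 * j + 1)) := by
  intro i j hij
  refine measure_eq_zero_iff_ae_notMem.2 ?_
  filter_upwards [ae_gaps_pos hr hS] with ω hω h
  have h1 := eventCount_eq_of_window hω h.1.1 h.1.2
  have h2 := eventCount_eq_of_window hω h.2.1 h.2.2
  omega

/-- Assembling the laws on the events of exactly `2n+1` Poisson events. No event is lost, as an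
infinite number of events gives the even junk value `0` of `eventCount`. -/
lemma hasLaw_restrict_odd [IsProbabilityMeasure P] {S : ℕ → Ω → ℝ} (hr : 0 < r)
    (hS : IsPoissonGaps P r S) {c t : ℝ} (hc : 0 < c) (ht : 0 < t) {X : Ω → ℝ}
    (h : ∀ n, HasLaw X (P (window S t (2 * n + 1)) • lineLaw n c t)
      (P.restrict (window S t (2 * n + 1)))) :
    HasLaw X (volume.withDensity fun x => ENNReal.ofReal (oddLineDensity r c t x))
      (P.restrict {ω | Odd (eventCount S t ω)}) := by
  have hU : {ω | Odd (eventCount S t ω)} =ᵐ[P] ⋃ n : ℕ, window S t (2 * n + 1) := by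
    filter_upwards [ae_gaps_pos hr hS] with ω hω
    refine propext ⟨?_, ?_⟩
    · rintro ⟨n, hn⟩
      exact Set.mem_iUnion.2 ⟨n, window_of_eventCount_eq hω ht.le (by omega) hn⟩
    · intro h
      obtain ⟨n, hn⟩ := Set.mem_iUnion.1 h
      exact ⟨n, eventCount_eq_of_window hω hn.1 hn.2⟩
  rw [Measure.restrict_congr_set hU, Measure.restrict_iUnion_ae (pairwise_disjoint_window hr hS t)
    fun n => nullMeasurableSet_window hS t _]
  have hX := aemeasurable_sum_measure_iff.2 fun n => (h n).aemeasurable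
  refine ⟨hX, ?_⟩
  rw [Measure.map_sum hX]
  simp_rw [(h _).map_eq, measure_window hr hS _ ht.le]
  exact sum_smul_lineLaw hr hc ht

/-- The events `window S t m` and the alternating sums are functions of the sequence of gaps, and
therefore independent of the initial sign. -/
lemma hasLaw_telegraph [IsProbabilityMeasure P] {S : ℕ → Ω → ℝ} {V : Ω → ℝ} (hr : 0 < r)
    (hT : IsTelegraph P r S V) {c t : ℝ} (hc : 0 < c) (ht : 0 < t) (n : ℕ) :
    HasLaw (telegraph c S V t) (P (window S t (2 * n + 1)) • lineLaw n c t)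
      (P.restrict (window S t (2 * n + 1))) := by
  have hS := hT.gaps
  set W := window S t (2 * n + 1) with hW
  set φ : (ℕ → ℝ) → ℝ := fun s => c * (2 * ∑ k ∈ Finset.range (n + 1), s (2 * k) - t) with hφ
  have hφm : Measurable φ := by fun_prop
  set B : Set (ℕ → ℝ) := {s | ∑ i ∈ Finset.range (2 * n + 1), s i ≤ t ∧
    t < ∑ i ∈ Finset.range (2 * n + 1 + 1), s i} with hBdef
  have hB : MeasurableSet B :=
    (measurableSet_le (f := fun s : ℕ → ℝ => ∑ i ∈ Finset.range (2 * n + 1), s i)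
      (by fun_prop) measurable_const).inter
      (measurableSet_lt (g := fun s : ℕ → ℝ => ∑ i ∈ Finset.range (2 * n + 1 + 1), s i)
      measurable_const (by fun_prop))
  have hpath : AEMeasurable (fun ω k => S k ω) P :=
    aemeasurable_pi_lambda _ fun k => (hS.law k).aemeasurable
  have hl : HasLaw (fun ω k => S k ω) (P.map fun ω k => S k ω) P := ⟨hpath, rfl⟩
  set lam := P.map fun ω k => S k ω
  have : IsProbabilityMeasure lam := Measure.isProbabilityMeasure_map hpath
  have hV := hT.law_sign
  have hprob : IsProbabilityMeasure
      ((2 : ℝ≥0∞)⁻¹ • Measure.dirac (1 : ℝ) + (2 : ℝ≥0∞)⁻¹ • Measure.dirac (-1 : ℝ)) :=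
    hV.isProbabilityMeasure_iff.1 inferInstance
  have hjoint := (indepFun_iff_hasLaw_prodMk_prod hV hl).1 hT.indep
  have hWB : W = (fun ω k => S k ω) ⁻¹' B := rfl
  have hWB' : W = (fun ω => (V ω, fun k => S k ω)) ⁻¹' (Set.univ ×ˢ B) := by
    ext ω; simp [hWB]
  have heq : telegraph c S V t =ᵐ[P.restrict W] fun ω => V ω * φ (fun k => S k ω) := by
    refine (ae_restrict_iff'₀ (nullMeasurableSet_window hS t _)).2 ?_
    filter_upwards [ae_gaps_pos hr hS] with ω hω hw
    exact telegraph_eq_of_window hω hw c V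
  have hm : AEMeasurable (fun ω => V ω * φ (fun k => S k ω)) (P.restrict W) :=
    (hV.aemeasurable.mul (hφm.comp_aemeasurable hpath)).restrict
  have hline : ∀ f : ℝ → ℝ≥0∞, Measurable f →
      ∫⁻ s in B, f (φ s) ∂lam = P W * ∫⁻ x, f x ∂(lineLaw n c t) := by
    intro f hf
    have h := hasLaw_alternating hr hS hc ht n
    have h2 := h.lintegral_comp hf.aemeasurable
    rw [lintegral_smul_measure, smul_eq_mul] at h2
    rw [← h2]
    exact (setLIntegral_comp_of_hasLaw hl hB (hf.comp hφm)).symm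
  refine HasLaw.congr ⟨hm, Measure.ext_of_lintegral _ fun f hf => ?_⟩ heq
  rw [lintegral_map' hf.aemeasurable hm, lintegral_smul_measure, smul_eq_mul, hWB',
    setLIntegral_comp_of_hasLaw hjoint (MeasurableSet.univ.prod hB)
      (f := fun p => f (p.1 * φ p.2)) (by fun_prop), ← Measure.prod_restrict,
    lintegral_prod _ (by fun_prop), Measure.restrict_univ, lintegral_add_measure,
    lintegral_smul_measure, lintegral_smul_measure, lintegral_dirac, lintegral_dirac]
  simp only [one_mul, neg_mul, smul_eq_mul]
  rw [hline f hf, hline (fun x => f (-x)) (by fun_prop), lintegral_lineLaw_neg _ _ _ hf,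
    ← add_mul, ENNReal.inv_two_add_inv_two, one_mul, ← hWB']

end

/-! ### Densities on finite product spaces -/

section

/-- Tonelli's theorem for a product of functions of the coordinates. -/
lemma lintegral_pi_prod {n : ℕ} {E : Type*} [MeasurableSpace E] {μ : Measure E} [SigmaFinite μ]
    {f : Fin n → E → ℝ≥0∞} (hf : ∀ i, Measurable (f i)) :
    ∫⁻ x, ∏ i, f i (x i) ∂(Measure.pi fun _ => μ) = ∏ i, ∫⁻ x, f i x ∂μ := by
  induction n with
  | zero => simp
  | succ n ih =>
    rw [← ((measurePreserving_piFinSuccAbove (fun _ => μ) 0).symm).lintegral_comp_emb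
      (MeasurableEquiv.measurableEmbedding _), Fin.prod_univ_succ, ← ih fun i => hf i.succ,
      ← lintegral_prod_mul (hf 0).aemeasurable (Finset.measurable_fun_prod _ fun i _ =>
        (hf i.succ).comp (measurable_pi_apply i)).aemeasurable]
    refine lintegral_congr fun x => ?_
    rw [Fin.prod_univ_succ]
    rfl

lemma pi_withDensity {n : ℕ} {E : Type*} [MeasurableSpace E] {μ : Measure E} [SigmaFinite μ]
    {g : E → ℝ≥0∞} (hg : Measurable g) [SigmaFinite (μ.withDensity g)] :
    Measure.pi (fun _ : Fin n => μ.withDensity g)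
      = (Measure.pi fun _ => μ).withDensity fun x => ∏ i, g (x i) := by
  refine (Measure.pi_eq fun s hs => ?_)
  rw [withDensity_apply _ (MeasurableSet.univ_pi hs), ← lintegral_indicator (.univ_pi hs)]
  simp_rw [withDensity_apply _ (hs _), ← lintegral_indicator (hs _)]
  rw [← lintegral_pi_prod fun i => hg.indicator (hs i)]
  refine lintegral_congr fun x => ?_
  by_cases hx : x ∈ Set.univ.pi s
  · rw [Set.indicator_of_mem hx]
    exact Finset.prod_congr rfl fun i _ => (Set.indicator_of_mem (hx i trivial) _).symm
  · rw [Set.indicator_of_notMem hx]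
    simp only [Set.mem_pi, Set.mem_univ, true_imp_iff, not_forall] at hx
    obtain ⟨i, hi⟩ := hx
    exact (Finset.prod_eq_zero (Finset.mem_univ i) (Set.indicator_of_notMem hi _)).symm

/-! ### Reduction to the flight with Dirichlet distributed steps -/

/-- Two consecutive gaps `(s, s')`, the first of which is the last one to be completed before the
remaining time `R` has elapsed: then `s` has constant density on `(0, R)`. -/
lemma lintegral_last_pair {r : ℝ} (hr : 0 < r) (R : ℝ) {g : ℝ → ℝ≥0∞} (hg : Measurable g) :
    ∫⁻ q in {q : ℝ × ℝ | q.1 ≤ R ∧ R < q.1 + q.2}, g q.1 ∂((expMeasure r).prod (expMeasure r))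
      = ENNReal.ofReal (r * Real.exp (-(r * R))) * ∫⁻ s in Set.Ioo 0 R, g s := by
  have := isProbabilityMeasure_expMeasure hr
  have hs : MeasurableSet {q : ℝ × ℝ | q.1 ≤ R ∧ R < q.1 + q.2} :=
    (measurableSet_le measurable_fst measurable_const).inter
      (measurableSet_lt measurable_const (measurable_fst.add measurable_snd))
  rw [← lintegral_indicator hs, lintegral_prod _
    ((Measurable.indicator (by fun_prop) hs).aemeasurable)]
  have hin : ∀ a, ∫⁻ b, {q : ℝ × ℝ | q.1 ≤ R ∧ R < q.1 + q.2}.indicator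
      (fun q => g q.1) (a, b) ∂(expMeasure r) =
      (Set.Iic R).indicator (fun a => g a * ENNReal.ofReal (Real.exp (-(r * (R - a))))) a := by
    intro a
    have e : ∫⁻ b, {q : ℝ × ℝ | q.1 ≤ R ∧ R < q.1 + q.2}.indicator
        (fun q => g q.1) (a, b) ∂(expMeasure r) =
        g a * expMeasure r (Prod.mk a ⁻¹' {q : ℝ × ℝ | q.1 ≤ R ∧ R < q.1 + q.2}) := by
      rw [← lintegral_indicator_const (measurable_prodMk_left hs)]
      rfl
    rw [e]
    by_cases ha : a ≤ R
    · have : Prod.mk a ⁻¹' {q : ℝ × ℝ | q.1 ≤ R ∧ R < q.1 + q.2} = Set.Ioi (R - a) := by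
        ext y; simp [ha, sub_lt_iff_lt_add']
      rw [this, expMeasure_Ioi hr (by linarith), Set.indicator_of_mem (by exact ha)]
    · have : Prod.mk a ⁻¹' {q : ℝ × ℝ | q.1 ≤ R ∧ R < q.1 + q.2} = ∅ := by
        ext y; simp [ha]
      rw [this, Set.indicator_of_notMem (by exact ha)]; simp
  simp_rw [hin]
  rw [lintegral_expMeasure (Measurable.indicator (by fun_prop) measurableSet_Iic),
    restrict_Ioo_eq_restrict_Ioc, ← Set.Ioi_inter_Iic, Set.inter_comm,
    ← lintegral_const_mul' _ _ ENNReal.ofReal_ne_top, ← setLIntegral_indicator measurableSet_Iic]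
  refine setLIntegral_congr_fun measurableSet_Ioi fun a ha => ?_
  by_cases hat : a ≤ R
  · simp only [Set.indicator_of_mem (show a ∈ Set.Iic R from hat)]
    rw [mul_comm (g a), ← mul_assoc, ← ENNReal.ofReal_mul (by positivity)]
    congr 2
    rw [mul_assoc, ← Real.exp_add]
    congr 2; ring
  · simp [hat]

variable {Ω : Type*} [MeasurableSpace Ω] {P : Measure Ω} {r : ℝ}

/-- The pairs of gaps `(S_{2k}, S_{2k+1})` are independent, with independent exponential
components. -/
lemma hasLaw_pairs [IsProbabilityMeasure P] (hr : 0 < r) {S : ℕ → Ω → ℝ}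
    (hS : IsPoissonGaps P r S) (m : ℕ) :
    HasLaw (fun ω (k : Fin m) => (S (2 * k) ω, S (2 * k + 1) ω))
      (Measure.pi fun _ => (expMeasure r).prod (expMeasure r)) P := by
  have := isProbabilityMeasure_expMeasure hr
  have hX : IsPoissonGaps P r fun k => S (2 * k) := hS.precomp fun a b h => by simpa using h
  have hY : IsPoissonGaps P r fun k => S (2 * k + 1) := hS.precomp fun a b h => by simpa using h
  have h1 := (hX.indep.precomp Fin.val_injective (g := fun k : Fin m => (k : ℕ))).hasLaw_pi
    fun k : Fin m => hX.law k
  have h2 := (hY.indep.precomp Fin.val_injective (g := fun k : Fin m => (k : ℕ))).hasLaw_pi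
    fun k : Fin m => hY.law k
  have h := (indepFun_iff_hasLaw_prodMk_prod h1 h2).1 (indepFun_even_odd hS m)
  exact (measurePreserving_arrowProdEquivProdArrow ℝ ℝ (Fin m) (fun _ => expMeasure r)
    fun _ => expMeasure r).symm.comp_hasLaw h

lemma hasLaw_pairs_last [IsProbabilityMeasure P] (hr : 0 < r) {S : ℕ → Ω → ℝ}
    (hS : IsPoissonGaps P r S) (n : ℕ) :
    HasLaw (fun ω => ((S (2 * n) ω, S (2 * n + 1) ω),
        fun k : Fin n => (S (2 * k) ω, S (2 * k + 1) ω)))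
      (((expMeasure r).prod (expMeasure r)).prod
        (Measure.pi fun _ => (expMeasure r).prod (expMeasure r))) P := by
  have := isProbabilityMeasure_expMeasure hr
  have h := (measurePreserving_piFinSuccAbove
    (fun _ : Fin (n + 1) => (expMeasure r).prod (expMeasure r)) (Fin.last n)).comp_hasLaw
    (hasLaw_pairs hr hS (n + 1))
  convert h using 1
  ext ω k <;> simp [MeasurableEquiv.piFinSuccAbove, Fin.insertNthEquiv, Fin.init]

/-- The event of exactly `2n+1` Poisson events up to time `t`, in terms of the pair of gaps with the
indices `2n`, `2n+1` and of the `n` pairs before it. -/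
def pairWindow (t : ℝ) (n : ℕ) : Set ((ℝ × ℝ) × (Fin n → ℝ × ℝ)) :=
  {q | q.1.1 ≤ t - ∑ k, ((q.2 k).1 + (q.2 k).2) ∧
    t - ∑ k, ((q.2 k).1 + (q.2 k).2) < q.1.1 + q.1.2}

lemma measurableSet_pairWindow (t : ℝ) (n : ℕ) : MeasurableSet (pairWindow t n) :=
  (measurableSet_le (f := fun q : (ℝ × ℝ) × (Fin n → ℝ × ℝ) => q.1.1)
    (g := fun q => t - ∑ k, ((q.2 k).1 + (q.2 k).2)) (by fun_prop) (by fun_prop)).inter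
  (measurableSet_lt (f := fun q : (ℝ × ℝ) × (Fin n → ℝ × ℝ) =>
    t - ∑ k, ((q.2 k).1 + (q.2 k).2)) (g := fun q => q.1.1 + q.1.2)
    (by fun_prop) (by fun_prop))

lemma window_eq_preimage_pairWindow {Ω : Type*} (S : ℕ → Ω → ℝ) (t : ℝ) (n : ℕ) :
    window S t (2 * n + 1) = (fun ω => ((S (2 * n) ω, S (2 * n + 1) ω),
      fun k : Fin n => (S (2 * k) ω, S (2 * k + 1) ω))) ⁻¹' pairWindow t n := by
  ext ω
  have h2 := eventTime_two_mul S (n + 1) ω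
  have h1 := eventTime_two_mul_add_one S n ω
  rw [show 2 * (n + 1) = 2 * n + 1 + 1 by ring] at h2
  simp only [window, pairWindow, Set.mem_ofPred_eq, h1, h2, Set.mem_preimage,
    Finset.sum_add_distrib, ← Finset.sum_range (fun k => S (2 * k) ω),
    ← Finset.sum_range (fun k => S (2 * k + 1) ω), Finset.sum_range_succ]
  constructor <;> rintro ⟨h, h'⟩ <;> constructor <;> linarith

/-- Given the `n` complete pairs `q`, the remaining time is `R = t - ∑ (q_k.1 + q_k.2)`, and the first
gap after them has constant density on `(0, R)`. -/
lemma lintegral_pairWindow (hr : 0 < r) (t : ℝ) (n : ℕ) {H : (Fin n → ℝ × ℝ) → ℝ → ℝ≥0∞}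
    (hH : Measurable (Function.uncurry H)) :
    ∫⁻ q in pairWindow t n, H q.2 q.1.1 ∂(((expMeasure r).prod (expMeasure r)).prod
        (Measure.pi fun _ => (expMeasure r).prod (expMeasure r)))
      = ∫⁻ q : Fin n → ℝ × ℝ, ENNReal.ofReal (r * Real.exp (-(r * (t - ∑ k, ((q k).1 + (q k).2))))) *
          (∫⁻ s in Set.Ioo 0 (t - ∑ k, ((q k).1 + (q k).2)), H q s)
        ∂(Measure.pi fun _ => (expMeasure r).prod (expMeasure r)) := by
  have := isProbabilityMeasure_expMeasure hr
  have hB := measurableSet_pairWindow t n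
  have hm : Measurable fun q : (ℝ × ℝ) × (Fin n → ℝ × ℝ) => H q.2 q.1.1 :=
    hH.comp (f := fun q : (ℝ × ℝ) × (Fin n → ℝ × ℝ) => (q.2, q.1.1)) (by fun_prop)
  rw [← lintegral_indicator hB, lintegral_prod_symm _ (hm.indicator hB).aemeasurable]
  refine lintegral_congr fun q => ?_
  rw [← lintegral_last_pair hr _ (g := H q) (hH.comp (f := fun s => (q, s)) (by fun_prop)),
    ← lintegral_indicator]
  · rfl
  · exact (measurableSet_le measurable_fst measurable_const).inter
      (measurableSet_lt measurable_const (measurable_fst.add measurable_snd))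

lemma map_add_expMeasure_prod (hr : 0 < r) :
    ((expMeasure r).prod (expMeasure r)).map (fun q => q.1 + q.2) = gammaMeasure 2 r := by
  have h := gammaMeasure_conv_expMeasure hr 0
  norm_num [Measure.conv] at h
  exact h

lemma lintegral_gammaMeasure_two {f : ℝ → ℝ≥0∞} (hf : Measurable f) :
    ∫⁻ x, f x ∂(gammaMeasure 2 r) = ∫⁻ x in Set.Ioi 0,
      ENNReal.ofReal (r ^ 2 * x * Real.exp (-(r * x))) * f x := by
  have := lintegral_gammaMeasure_natCast (r := r) 1 hf
  norm_num at this
  exact this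

lemma measurable_allSteps {n : ℕ} (t : ℝ) (j : Fin (n + 1)) :
    Measurable fun τ : Fin n → ℝ => allSteps t τ j := by
  unfold allSteps
  induction j using Fin.lastCases with
  | last => simp only [Fin.snoc_last]; fun_prop
  | cast i => simp only [Fin.snoc_castSucc]; fun_prop

lemma allSteps_pos_iff {n : ℕ} (t : ℝ) (τ : Fin n → ℝ) :
    (∀ j, 0 < allSteps t τ j) ↔ (∀ i, 0 < τ i) ∧ 0 < t - ∑ i, τ i := by
  simp [Fin.forall_fin_succ', allSteps]

/-- The Dirichlet distribution of the step durations of the three-dimensional flight. -/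
noncomputable def dirichletLaw (n : ℕ) (t : ℝ) : Measure (Fin n → ℝ) :=
  volume.withDensity fun τ => ENNReal.ofReal (dirichletDensity 3 n t τ)

/-- In dimension three the parameters of the Dirichlet distribution are all equal to `2`. -/
lemma dirichletDensity_three {n : ℕ} {t : ℝ} {τ : Fin n → ℝ}
    (h : (∀ i, 0 < τ i) ∧ 0 < t - ∑ i, τ i) :
    dirichletDensity 3 n t τ
      = (2 * n + 1).factorial / t ^ (2 * n + 1) * ((∏ i, τ i) * (t - ∑ i, τ i)) := by
  rw [dirichletDensity, if_pos ((allSteps_pos_iff t τ).2 h), Fin.prod_univ_castSucc]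
  have e1 : ((n : ℝ) + 1) * (((3 : ℕ) : ℝ) - 1) = ((2 * n + 1 : ℕ) : ℝ) + 1 := by
    push_cast; ring
  have e2 : (((3 : ℕ) : ℝ) - 1) = ((1 : ℕ) : ℝ) + 1 := by norm_num
  have e3 : (((3 : ℕ) : ℝ) - 2) = 1 := by norm_num
  rw [e1, e2, e3, Real.Gamma_nat_eq_factorial, Real.Gamma_nat_eq_factorial, add_sub_cancel_right,
    Real.rpow_natCast]
  simp only [allSteps, Fin.snoc_castSucc, Fin.snoc_last, Real.rpow_one, Nat.factorial_one,
    Nat.cast_one, one_pow]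
  ring

/-- Independent `Gamma(2)` step durations, weighted with the probability `r R e^{-rR}` that the
remaining time `R = t - ∑ τ` is covered by a last step with exactly one Poisson event, have a
Dirichlet distribution. -/
lemma dirichletLaw_eq_withDensity (hr : 0 < r) {t : ℝ} (ht : 0 < t) (n : ℕ) :
    ENNReal.ofReal (Real.exp (-(r * t)) * (r * t) ^ (2 * n + 1) / (2 * n + 1).factorial) •
        dirichletLaw n t
      = (Measure.pi fun _ : Fin n => gammaMeasure 2 r).withDensity fun τ =>
        ENNReal.ofReal (r * Real.exp (-(r * (t - ∑ i, τ i)))) *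
          ENNReal.ofReal (t - ∑ i, τ i) := by
  have hprob := isProbabilityMeasure_gammaMeasure (a := 2) (by positivity) hr
  have hgm : Measurable ((Set.Ioi (0 : ℝ)).indicator fun x =>
      ENNReal.ofReal (r ^ 2 * x * Real.exp (-(r * x)))) :=
    Measurable.indicator (by fun_prop) measurableSet_Ioi
  have hγ : gammaMeasure 2 r = volume.withDensity ((Set.Ioi (0 : ℝ)).indicator fun x =>
      ENNReal.ofReal (r ^ 2 * x * Real.exp (-(r * x)))) := by
    refine Measure.ext_of_lintegral _ fun f hf => ?_
    rw [lintegral_gammaMeasure_two hf, lintegral_withDensity_eq_lintegral_mul _ hgm hf,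
      ← lintegral_indicator measurableSet_Ioi]
    refine lintegral_congr fun x => ?_
    by_cases hx : 0 < x <;> simp [Set.indicator, hx]
  have hprodm : Measurable fun x : Fin n → ℝ => ∏ i, (Set.Ioi (0 : ℝ)).indicator (fun x =>
      ENNReal.ofReal (r ^ 2 * x * Real.exp (-(r * x)))) (x i) :=
    Finset.measurable_fun_prod _ fun i _ => hgm.comp (measurable_pi_apply i)
  rw [hγ] at hprob ⊢
  rw [pi_withDensity hgm, ← withDensity_mul _ hprodm (by fun_prop), dirichletLaw,
    ← withDensity_smul' _ _ ENNReal.ofReal_ne_top]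
  change (volume : Measure (Fin n → ℝ)).withDensity _ = (volume : Measure (Fin n → ℝ)).withDensity _
  congr 1
  ext τ
  simp only [Pi.smul_apply, smul_eq_mul, Pi.mul_apply]
  by_cases h1 : ∀ i, 0 < τ i
  · by_cases h2 : 0 < t - ∑ i, τ i
    · rw [dirichletDensity_three ⟨h1, h2⟩]
      have hp : ∏ i, (Set.Ioi (0 : ℝ)).indicator (fun x =>
          ENNReal.ofReal (r ^ 2 * x * Real.exp (-(r * x)))) (τ i)
          = ENNReal.ofReal (∏ i, r ^ 2 * τ i * Real.exp (-(r * τ i))) := by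
        rw [ENNReal.ofReal_prod_of_nonneg fun i _ => by have := h1 i; positivity]
        exact Finset.prod_congr rfl fun i _ => Set.indicator_of_mem (h1 i) _
      rw [hp, ← ENNReal.ofReal_mul (by positivity), ← ENNReal.ofReal_mul (by positivity),
        ← ENNReal.ofReal_mul (Finset.prod_nonneg fun i _ => by have := h1 i; positivity)]
      congr 1
      rw [Finset.prod_mul_distrib, Finset.prod_mul_distrib, ← Real.exp_sum,
        Finset.sum_neg_distrib, ← Finset.mul_sum]
      have : Real.exp (-(r * t)) = Real.exp (-(r * ∑ i, τ i)) *
          Real.exp (-(r * (t - ∑ i, τ i))) := by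
        rw [← Real.exp_add]; congr 1; ring
      rw [this, mul_pow]
      simp
      field_simp
      ring
    · rw [dirichletDensity, if_neg (fun h => h2 ((allSteps_pos_iff t τ).1 h).2),
        ENNReal.ofReal_eq_zero.2 (not_lt.1 h2)]
      simp
  · rw [dirichletDensity, if_neg (fun h => h1 ((allSteps_pos_iff t τ).1 h).1)]
    push Not at h1
    obtain ⟨i, hi⟩ := h1
    have hz : ∏ i, (Set.Ioi (0 : ℝ)).indicator (fun x =>
        ENNReal.ofReal (r ^ 2 * x * Real.exp (-(r * x)))) (τ i) = 0 :=
      Finset.prod_eq_zero (Finset.mem_univ i) (Set.indicator_of_notMem (by simpa using hi) _)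
    rw [hz]
    simp

instance isProbabilityMeasure_uniformSphere : IsProbabilityMeasure (uniformSphere 3) := by
  unfold uniformSphere
  have : IsProbabilityMeasure (((volume : Measure (EuclideanSpace ℝ (Fin 3))).toSphere
      Set.univ)⁻¹ • (volume : Measure (EuclideanSpace ℝ (Fin 3))).toSphere) := by
    refine ⟨?_⟩
    rw [Measure.smul_apply, smul_eq_mul]
    exact ENNReal.inv_mul_cancel
      (Measure.measure_univ_ne_zero.2 (Measure.toSphere_ne_zero _)) (measure_ne_top _ _)
  exact Measure.isProbabilityMeasure_map measurable_subtype_coe.aemeasurable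

/-- The position after straight steps with durations `allSteps t τ` in the directions `d`. -/
noncomputable def flightPos {n : ℕ} (c t : ℝ)
    (p : (Fin n → ℝ) × (Fin (n + 1) → EuclideanSpace ℝ (Fin 3))) : EuclideanSpace ℝ (Fin 3) :=
  c • ∑ j, allSteps t p.1 j • p.2 j

lemma measurable_flightPos {n : ℕ} (c t : ℝ) : Measurable (flightPos (n := n) c t) := by
  unfold flightPos
  refine Measurable.const_smul (Finset.measurable_fun_sum _ fun j _ => ?_) c
  exact ((measurable_allSteps t j).comp measurable_fst).smul
    ((measurable_pi_apply j).comp measurable_snd)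

lemma dirichletFlightLaw_three (n : ℕ) (c t : ℝ) : dirichletFlightLaw 3 n c t
    = ((dirichletLaw n t).prod (Measure.pi fun _ => uniformSphere 3)).map (flightPos c t) := rfl

/-- On the event of exactly `2n+1` Poisson events there are `n` complete steps, each made of two gaps,
and a last one which is interrupted at time `t`. -/
lemma evenFlight_eq_of_window {Ω : Type*} {S : ℕ → Ω → ℝ} {ω : Ω} (h : ∀ k, 0 < S k ω) {t : ℝ}
    {n : ℕ} (hw : ω ∈ window S t (2 * n + 1)) (c : ℝ) (D : ℕ → Ω → EuclideanSpace ℝ (Fin 3)) :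
    evenFlight c S D t ω = flightPos c t
      (fun k : Fin n => S (2 * k) ω + S (2 * k + 1) ω, fun k : Fin (n + 1) => D k ω) := by
  have hmono := eventTime_strictMono h
  have hN : eventCount S t ω / 2 = n := by
    rw [eventCount_eq_of_window h hw.1 hw.2]; omega
  rw [evenFlight, hN, flightPos, Finset.sum_range, Fin.sum_univ_castSucc, Fin.sum_univ_castSucc]
  congr 2
  · refine Finset.sum_congr rfl fun k _ => ?_
    have hk : eventTime S (2 * k + 2) ω ≤ t :=
      (hmono.monotone (by have := k.2; omega : 2 * (k : ℕ) + 2 ≤ 2 * n + 1)).trans hw.1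
    simp only [Fin.val_castSucc, min_eq_left hk, allSteps, Fin.snoc_castSucc]
    congr 1
    simp only [eventTime, Finset.sum_range_succ]
    ring
  · simp only [Fin.val_last, allSteps, Fin.snoc_last]
    rw [min_eq_right hw.2.le, eventTime_two_mul, Finset.sum_add_distrib, Finset.sum_range,
      Finset.sum_range]

/-- On the event of exactly `2n+1` Poisson events the even flight is distributed as the flight with
Dirichlet distributed steps. -/
lemma hasLaw_evenFlight [IsProbabilityMeasure P] (hr : 0 < r) {S : ℕ → Ω → ℝ}
    {D : ℕ → Ω → EuclideanSpace ℝ (Fin 3)} (hU : IsEvenFlight P r S D) (c : ℝ) {t : ℝ}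
    (ht : 0 < t) (n : ℕ) :
    HasLaw (evenFlight c S D t) (P (window S t (2 * n + 1)) • dirichletFlightLaw 3 n c t)
      (P.restrict (window S t (2 * n + 1))) := by
  have hS := hU.gaps
  have := isProbabilityMeasure_expMeasure hr
  have := isProbabilityMeasure_gammaMeasure (a := 2) (by positivity) hr
  have hQ := hasLaw_pairs_last hr hS n
  have hD := (hU.indep_dir.precomp Fin.val_injective
    (g := fun k : Fin (n + 1) => (k : ℕ))).hasLaw_pi fun k : Fin (n + 1) => hU.law_dir k
  have hind : IndepFun (fun ω => ((S (2 * n) ω, S (2 * n + 1) ω),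
      fun k : Fin n => (S (2 * k) ω, S (2 * k + 1) ω)))
      (fun ω (k : Fin (n + 1)) => D k ω) P :=
    hU.indep.comp
      (φ := fun s : ℕ → ℝ => ((s (2 * n), s (2 * n + 1)),
        fun k : Fin n => (s (2 * k), s (2 * k + 1))))
      (ψ := fun (d : ℕ → EuclideanSpace ℝ (Fin 3)) (k : Fin (n + 1)) => d k) (by fun_prop) (by fun_prop)
  have hZ := (indepFun_iff_hasLaw_prodMk_prod hQ hD).1 hind
  set Z := fun ω => (((S (2 * n) ω, S (2 * n + 1) ω),
      fun k : Fin n => (S (2 * k) ω, S (2 * k + 1) ω)), fun k : Fin (n + 1) => D k ω) with hZdef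
  set B₀ := pairWindow t n
  have hB₀ : MeasurableSet B₀ := measurableSet_pairWindow t n
  have hW : window S t (2 * n + 1) = Z ⁻¹' (B₀ ×ˢ Set.univ) := by
    rw [window_eq_preimage_pairWindow]
    ext ω
    simp [Z, B₀]
  set W := window S t (2 * n + 1) with hWdef
  have heq : evenFlight c S D t =ᵐ[P.restrict W] fun ω => flightPos c t
      (fun k => ((Z ω).1.2 k).1 + ((Z ω).1.2 k).2, (Z ω).2) := by
    refine (ae_restrict_iff'₀ (nullMeasurableSet_window hS t _)).2 ?_
    filter_upwards [ae_gaps_pos hr hS] with ω hω hw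
    exact evenFlight_eq_of_window hω hw c D
  have hΦ : Measurable fun z : ((ℝ × ℝ) × (Fin n → ℝ × ℝ)) ×
      (Fin (n + 1) → EuclideanSpace ℝ (Fin 3)) => flightPos c t
      (fun k => (z.1.2 k).1 + (z.1.2 k).2, z.2) :=
    (measurable_flightPos c t).comp (by fun_prop)
  have hm := (hΦ.comp_aemeasurable hZ.aemeasurable).restrict (s := W)
  refine HasLaw.congr ⟨hm, Measure.ext_of_lintegral _ fun f hf => ?_⟩ heq
  rw [lintegral_map' hf.aemeasurable hm, hW]
  have h1 := setLIntegral_comp_of_hasLaw hZ (hB₀.prod MeasurableSet.univ)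
    (f := fun z => f (flightPos c t (fun k => (z.1.2 k).1 + (z.1.2 k).2, z.2))) (hf.comp hΦ)
  refine h1.trans ?_
  rw [← hW, measure_window hr hS _ ht.le, lintegral_smul_measure, smul_eq_mul,
    dirichletFlightLaw_three, lintegral_map hf (measurable_flightPos c t),
    ← Measure.prod_restrict, Measure.restrict_univ]
  -- integrate out the directions
  set H : (Fin n → ℝ) → ℝ≥0∞ := fun τ =>
    ∫⁻ d, f (flightPos c t (τ, d)) ∂(Measure.pi fun _ => uniformSphere 3) with hH
  have hHm : Measurable H :=
    Measurable.lintegral_prod_right' (hf.comp (measurable_flightPos c t))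
  have : SFinite (dirichletLaw n t) := by unfold dirichletLaw; infer_instance
  have hm₁ : Measurable fun z : ((ℝ × ℝ) × (Fin n → ℝ × ℝ)) ×
      (Fin (n + 1) → EuclideanSpace ℝ (Fin 3)) => f (flightPos c t
      (fun k => (z.1.2 k).1 + (z.1.2 k).2, z.2)) := hf.comp hΦ
  have hm₂ : Measurable fun p : (Fin n → ℝ) × (Fin (n + 1) → EuclideanSpace ℝ (Fin 3)) =>
      f (flightPos c t p) := hf.comp (measurable_flightPos c t)
  rw [lintegral_prod _ hm₁.aemeasurable, lintegral_prod _ hm₂.aemeasurable]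
  change ∫⁻ q in B₀, H (fun k => (q.2 k).1 + (q.2 k).2) ∂_ = _ * ∫⁻ τ, H τ ∂_
  rw [← smul_eq_mul, ← lintegral_smul_measure, dirichletLaw_eq_withDensity hr ht,
    lintegral_withDensity_eq_lintegral_mul _ (by fun_prop) hHm, ← map_add_expMeasure_prod hr,
    ← Measure.pi_map_pi (fun _ => by fun_prop), lintegral_map (by fun_prop) (by fun_prop)]
  refine (lintegral_pairWindow hr t n (H := fun q _ => H fun k => (q k).1 + (q k).2)
    (hHm.comp (by fun_prop))).trans (lintegral_congr fun q => ?_)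
  rw [lintegral_const (μ := volume.restrict _), Measure.restrict_apply_univ, Real.volume_Ioo,
    sub_zero, Pi.mul_apply, mul_assoc, mul_comm (ENNReal.ofReal (t - _))]

end

/-! ### The uniform distribution on the sphere in three dimensions -/

/-- Polar coordinates in the plane, with the squared radius as variable. -/
lemma lintegral_radial_plane {G : ℝ → ℝ≥0∞} (hG : Measurable G) :
    ∫⁻ y : ℝ × ℝ, G (y.1 ^ 2 + y.2 ^ 2) = ENNReal.ofReal Real.pi * ∫⁻ v in Set.Ioi 0, G v := by
  rw [← lintegral_comp_polarCoord_symm]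
  have h1 : ∀ p : ℝ × ℝ, (polarCoord.symm p).1 ^ 2 + (polarCoord.symm p).2 ^ 2 = p.1 ^ 2 := by
    intro p
    simp only [polarCoord_symm_apply]
    nlinarith [Real.sin_sq_add_cos_sq p.2]
  simp_rw [h1]
  rw [polarCoord_target, Measure.volume_eq_prod, ← Measure.prod_restrict,
    lintegral_prod _ (by fun_prop)]
  simp only [smul_eq_mul, lintegral_const, Measure.restrict_apply MeasurableSet.univ,
    Set.univ_inter, Real.volume_Ioo]
  have himg : (fun x : ℝ => x ^ 2) '' Set.Ioi 0 = Set.Ioi 0 := by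
    ext v
    constructor
    · rintro ⟨x, hx, rfl⟩
      exact Set.mem_Ioi.2 (pow_pos (Set.mem_Ioi.1 hx) 2)
    · intro hv
      exact ⟨Real.sqrt v, Real.sqrt_pos.2 hv, Real.sq_sqrt (le_of_lt hv)⟩
  have h2 := lintegral_image_eq_lintegral_abs_deriv_mul (s := Set.Ioi (0 : ℝ))
    (f := fun x => x ^ 2) (f' := fun x => 2 * x) measurableSet_Ioi
    (fun x _ => by simpa using (hasDerivAt_pow 2 x).hasDerivWithinAt)
    (fun x hx y hy hxy => by
      have hx' : (0 : ℝ) < x := hx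
      have hy' : (0 : ℝ) < y := hy
      exact (pow_left_inj₀ hx'.le hy'.le two_ne_zero).1 hxy) G
  rw [himg] at h2
  rw [h2, ← lintegral_const_mul' _ _ ENNReal.ofReal_ne_top]
  refine setLIntegral_congr_fun measurableSet_Ioi fun x hx => ?_
  have hx' : (0 : ℝ) < x := hx
  rw [mul_right_comm, ← mul_assoc, ← ENNReal.ofReal_mul hx'.le,
    ← ENNReal.ofReal_mul Real.pi_pos.le, abs_of_pos (by positivity)]
  congr 2
  ring

/-- Integration of a function of the first coordinate and the squared norm over `ℝ³`. -/
lemma lintegral_fst_normSq {F : ℝ → ℝ → ℝ≥0∞} (hF : Measurable (Function.uncurry F)) :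
    ∫⁻ x : EuclideanSpace ℝ (Fin 3), F (x 0) (‖x‖ ^ 2)
      = ENNReal.ofReal Real.pi * ∫⁻ a, ∫⁻ v in Set.Ioi 0, F a (a ^ 2 + v) := by
  have hF' : ∀ {g h : EuclideanSpace ℝ (Fin 3) → ℝ}, Measurable g → Measurable h →
      Measurable fun x => F (g x) (h x) := fun hg hh => hF.comp (hg.prodMk hh)
  have e1 : ∫⁻ x : EuclideanSpace ℝ (Fin 3), F (x 0) (‖x‖ ^ 2)
      = ∫⁻ y : Fin 3 → ℝ, F (y 0) (y 0 ^ 2 + (y 1 ^ 2 + y 2 ^ 2)) := by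
    rw [← (PiLp.volume_preserving_ofLp (Fin 3)).lintegral_comp
      (f := fun y : Fin 3 → ℝ => F (y 0) (y 0 ^ 2 + (y 1 ^ 2 + y 2 ^ 2)))
      (hF.comp (f := fun y : Fin 3 → ℝ => (y 0, y 0 ^ 2 + (y 1 ^ 2 + y 2 ^ 2))) (by fun_prop))]
    refine lintegral_congr fun x => ?_
    rw [EuclideanSpace.norm_sq_eq, Fin.sum_univ_three]
    simp [add_assoc]
  have e2 : ∫⁻ y : Fin 3 → ℝ, F (y 0) (y 0 ^ 2 + (y 1 ^ 2 + y 2 ^ 2))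
      = ∫⁻ p : ℝ × (Fin 2 → ℝ), F p.1 (p.1 ^ 2 + (p.2 0 ^ 2 + p.2 1 ^ 2)) := by
    rw [← (volume_preserving_piFinSuccAbove (fun _ : Fin 3 => ℝ) 0).symm.lintegral_comp_emb
      (MeasurableEquiv.measurableEmbedding _)]
    rfl
  have hm : Measurable fun p : ℝ × (Fin 2 → ℝ) => F p.1 (p.1 ^ 2 + (p.2 0 ^ 2 + p.2 1 ^ 2)) :=
    hF.comp (f := fun p : ℝ × (Fin 2 → ℝ) => (p.1, p.1 ^ 2 + (p.2 0 ^ 2 + p.2 1 ^ 2)))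
      (by fun_prop)
  rw [e1, e2, Measure.volume_eq_prod, lintegral_prod _ hm.aemeasurable,
    ← lintegral_const_mul' _ _ ENNReal.ofReal_ne_top]
  refine lintegral_congr fun a => ?_
  have hma : Measurable fun v => F a (a ^ 2 + v) :=
    hF.comp (f := fun v => (a, a ^ 2 + v)) (by fun_prop)
  rw [← lintegral_radial_plane hma]
  exact (volume_preserving_finTwoArrow ℝ).lintegral_comp_emb
    (MeasurableEquiv.measurableEmbedding _) (fun y : ℝ × ℝ => F a (a ^ 2 + (y.1 ^ 2 + y.2 ^ 2)))

/-- Up to a constant, the uniform distribution on the sphere measures the cone over a set. -/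
lemma exists_uniformSphere_apply : ∃ K : ℝ≥0∞, ∀ B : Set (EuclideanSpace ℝ (Fin 3)),
    MeasurableSet B → uniformSphere 3 B
      = K * volume {x : EuclideanSpace ℝ (Fin 3) | 0 < ‖x‖ ∧ ‖x‖ < 1 ∧ ‖x‖⁻¹ • x ∈ B} := by
  refine ⟨((volume : Measure (EuclideanSpace ℝ (Fin 3))).toSphere Set.univ)⁻¹ *
    Module.finrank ℝ (EuclideanSpace ℝ (Fin 3)), fun B hB => ?_⟩
  rw [uniformSphere, Measure.map_apply measurable_subtype_coe hB, Measure.smul_apply, smul_eq_mul,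
    Measure.toSphere_apply' _ (measurable_subtype_coe hB), mul_assoc]
  congr 3
  ext x
  rw [Set.mem_smul]
  constructor
  · rintro ⟨s, hs, _, ⟨v, hv, rfl⟩, rfl⟩
    have hv1 : ‖(v : EuclideanSpace ℝ (Fin 3))‖ = 1 := by simp
    have hn : ‖s • (v : EuclideanSpace ℝ (Fin 3))‖ = s := by
      rw [norm_smul, hv1, mul_one, Real.norm_of_nonneg hs.1.le]
    refine ⟨hn.symm ▸ hs.1, hn.symm ▸ hs.2, ?_⟩
    rw [hn, smul_smul, inv_mul_cancel₀ hs.1.ne', one_smul]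
    exact hv
  · rintro ⟨h0, h1, hB'⟩
    refine ⟨‖x‖, ⟨h0, h1⟩, ‖x‖⁻¹ • x, ⟨⟨‖x‖⁻¹ • x, ?_⟩, hB', rfl⟩, ?_⟩
    · rw [mem_sphere_zero_iff_norm, norm_smul, norm_inv, norm_norm, inv_mul_cancel₀ h0.ne']
    · rw [smul_smul, mul_inv_cancel₀ h0.ne', one_smul]

lemma map_linearIsometryEquiv_uniformSphere
    (L : EuclideanSpace ℝ (Fin 3) ≃ₗᵢ[ℝ] EuclideanSpace ℝ (Fin 3)) :
    (uniformSphere 3).map L = uniformSphere 3 := by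
  obtain ⟨K, hK⟩ := exists_uniformSphere_apply
  have hL : Measurable L := L.continuous.measurable
  ext B hB
  rw [Measure.map_apply hL hB, hK _ (hL hB), hK _ hB]
  congr 1
  rw [← L.measurePreserving.measure_preimage_emb L.toHomeomorph.measurableEmbedding
    {x | 0 < ‖x‖ ∧ ‖x‖ < 1 ∧ ‖x‖⁻¹ • x ∈ B}]
  congr 1
  ext x
  simp

/-- The uniform probability distribution on the interval `(-1, 1)`. -/
noncomputable def intervalLaw : Measure ℝ := (2 : ℝ≥0∞)⁻¹ • volume.restrict (Set.Ioo (-1) 1)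

instance : IsProbabilityMeasure intervalLaw := by
  refine ⟨?_⟩
  rw [intervalLaw, Measure.smul_apply, Measure.restrict_apply_univ, Real.volume_Ioo, smul_eq_mul]
  norm_num
  exact ENNReal.inv_mul_cancel (by simp) (by simp)

lemma lintegral_intervalLaw_mul {R : ℝ} (hR : 0 < R) {g : ℝ → ℝ≥0∞} (hg : Measurable g) :
    ENNReal.ofReal R * ∫⁻ w, g (R * w) ∂intervalLaw
      = (2 : ℝ≥0∞)⁻¹ * ∫⁻ x in Set.Ioo (-R) R, g x := by
  have h := lintegral_comp_affine hR.ne' 0 (hg.indicator (measurableSet_Ioo (a := -R) (b := R)))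
  have h' : ∀ w, (Set.Ioo (-R) R).indicator g (R * w + 0)
      = (Set.Ioo (-1 : ℝ) 1).indicator (fun w => g (R * w)) w := by
    intro w
    have : R * w + 0 ∈ Set.Ioo (-R) R ↔ w ∈ Set.Ioo (-1 : ℝ) 1 := by
      rw [add_zero, Set.mem_Ioo, Set.mem_Ioo]
      constructor <;> rintro ⟨h1, h2⟩ <;> constructor <;> nlinarith
    by_cases hw : w ∈ Set.Ioo (-1 : ℝ) 1
    · rw [Set.indicator_of_mem hw, Set.indicator_of_mem (this.2 hw), add_zero]
    · rw [Set.indicator_of_notMem hw, Set.indicator_of_notMem (fun h => hw (this.1 h))]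
  simp_rw [h'] at h
  rw [lintegral_indicator measurableSet_Ioo, lintegral_indicator measurableSet_Ioo] at h
  rw [intervalLaw, lintegral_smul_measure, h, smul_eq_mul, abs_of_pos (inv_pos.2 hR),
    mul_left_comm, ← mul_assoc (ENNReal.ofReal R), ← ENNReal.ofReal_mul hR.le,
    mul_inv_cancel₀ hR.ne', ENNReal.ofReal_one, one_mul]

/-- If `s` is uniform on `(0, R)`, then `s - (R - s)` is distributed like `R w` with `w` uniform on
`(-1, 1)`. -/
lemma lintegral_intervalLaw_affine {R : ℝ} (hR : 0 < R) {g : ℝ → ℝ≥0∞} (hg : Measurable g) :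
    ∫⁻ s in Set.Ioo 0 R, g (2 * s - R) = ENNReal.ofReal R * ∫⁻ w, g (R * w) ∂intervalLaw := by
  rw [lintegral_intervalLaw_mul hR hg]
  have h := lintegral_comp_affine two_ne_zero (-R)
    (hg.indicator (measurableSet_Ioo (a := -R) (b := R)))
  have h' : ∀ s, (Set.Ioo (-R) R).indicator g (2 * s + -R)
      = (Set.Ioo 0 R).indicator (fun s => g (2 * s - R)) s := by
    intro s
    have : 2 * s + -R ∈ Set.Ioo (-R) R ↔ s ∈ Set.Ioo 0 R := by
      rw [Set.mem_Ioo, Set.mem_Ioo]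
      constructor <;> rintro ⟨h1, h2⟩ <;> constructor <;> linarith
    by_cases hs : s ∈ Set.Ioo 0 R
    · rw [Set.indicator_of_mem hs, Set.indicator_of_mem (this.2 hs), sub_eq_add_neg]
    · rw [Set.indicator_of_notMem hs, Set.indicator_of_notMem (fun h => hs (this.1 h))]
  simp_rw [h'] at h
  rw [lintegral_indicator measurableSet_Ioo, lintegral_indicator measurableSet_Ioo] at h
  rw [h]
  congr 1
  rw [abs_of_pos (by norm_num), ENNReal.ofReal_inv_of_pos two_pos]
  simp

/-- **Archimedes' hat-box theorem**: a coordinate of a uniform point of the sphere in `ℝ³` is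
uniformly distributed on `(-1, 1)`. -/
lemma map_coord_uniformSphere : (uniformSphere 3).map (fun x => x 0) = intervalLaw := by
  obtain ⟨K, hK⟩ := exists_uniformSphere_apply
  have hco : Measurable fun x : EuclideanSpace ℝ (Fin 3) => x 0 := by fun_prop
  -- up to a constant, the volume of a cone is the length of the projection of its base
  have key : ∀ B : Set ℝ, MeasurableSet B → (uniformSphere 3).map (fun x => x 0) B
      = K * (ENNReal.ofReal Real.pi * ((∫⁻ w in Set.Ioo (0 : ℝ) 1, ENNReal.ofReal (Real.sqrt w)) *
        (2 * intervalLaw B))) := by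
    intro B hB
    rw [Measure.map_apply hco hB, hK _ (hco hB)]
    congr 1
    set F : ℝ → ℝ → ℝ≥0∞ := fun a w => (Set.Ioo (0 : ℝ) 1).indicator
      (fun w => B.indicator 1 (a / Real.sqrt w)) w with hFdef
    have hF : Measurable (Function.uncurry F) := by
      have : Function.uncurry F = Set.indicator (Prod.snd ⁻¹' Set.Ioo (0 : ℝ) 1)
          (fun p : ℝ × ℝ => B.indicator 1 (p.1 / Real.sqrt p.2)) := by
        ext ⟨a, w⟩
        simp [F, Set.indicator]
      rw [this]
      refine Measurable.indicator ?_ (measurable_snd measurableSet_Ioo)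
      exact (measurable_one.indicator hB).comp (by fun_prop)
    have hset : MeasurableSet {x : EuclideanSpace ℝ (Fin 3) | 0 < ‖x‖ ∧ ‖x‖ < 1 ∧
        ‖x‖⁻¹ • x ∈ (fun x : EuclideanSpace ℝ (Fin 3) => x 0) ⁻¹' B} := by
      refine (measurableSet_lt measurable_const measurable_norm).inter
        ((measurableSet_lt measurable_norm measurable_const).inter ?_)
      exact (measurable_norm.inv.smul measurable_id) (hco hB)
    rw [← lintegral_indicator_one hset]
    have e : ∀ x : EuclideanSpace ℝ (Fin 3), Set.indicator {x : EuclideanSpace ℝ (Fin 3) |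
        0 < ‖x‖ ∧ ‖x‖ < 1 ∧ ‖x‖⁻¹ • x ∈ (fun x : EuclideanSpace ℝ (Fin 3) => x 0) ⁻¹' B} 1 x
        = F (x 0) (‖x‖ ^ 2) := by
      intro x
      by_cases h0 : 0 < ‖x‖
      · by_cases h1 : ‖x‖ < 1
        · have : ‖x‖ ^ 2 ∈ Set.Ioo (0 : ℝ) 1 := ⟨by positivity, by nlinarith⟩
          simp only [F, Set.indicator_of_mem this, Real.sqrt_sq (norm_nonneg x)]
          by_cases hb : ‖x‖⁻¹ * x 0 ∈ B <;>
            simp [Set.indicator, norm_pos_iff.1 h0, h1, hb, div_eq_inv_mul]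
        · have : ¬ ‖x‖ ^ 2 < 1 := by nlinarith
          simp [F, Set.indicator, h1]
      · have : ‖x‖ = 0 := le_antisymm (not_lt.1 h0) (norm_nonneg x)
        simp [F, Set.indicator, this]
    simp_rw [e]
    rw [lintegral_fst_normSq hF]
    congr 1
    -- Fubini in the half-plane above the parabola `w = a²`
    have e1 : ∀ a, ∫⁻ v in Set.Ioi 0, F a (a ^ 2 + v)
        = ∫⁻ w, {p : ℝ × ℝ | p.1 ^ 2 < p.2}.indicator (Function.uncurry F) (a, w) := by
      intro a
      rw [← lintegral_indicator measurableSet_Ioi,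
        ← lintegral_add_left_eq_self (fun w => {p : ℝ × ℝ | p.1 ^ 2 < p.2}.indicator
          (Function.uncurry F) (a, w)) (a ^ 2)]
      congr with v
      simp [Set.indicator]
    have hpar : MeasurableSet {p : ℝ × ℝ | p.1 ^ 2 < p.2} :=
      measurableSet_lt (by fun_prop) measurable_snd
    simp_rw [e1]
    rw [lintegral_lintegral_swap (f := fun a w => {p : ℝ × ℝ | p.1 ^ 2 < p.2}.indicator
      (Function.uncurry F) (a, w)) (hF.indicator hpar).aemeasurable,
      ← lintegral_mul_const _ (by fun_prop), ← lintegral_indicator measurableSet_Ioo]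
    refine lintegral_congr fun w => ?_
    by_cases hw : w ∈ Set.Ioo (0 : ℝ) 1
    · rw [Set.indicator_of_mem hw]
      have hs : 0 < Real.sqrt w := Real.sqrt_pos.2 hw.1
      have e2 : ∀ a, {p : ℝ × ℝ | p.1 ^ 2 < p.2}.indicator (Function.uncurry F) (a, w)
          = (Set.Ioo (-Real.sqrt w) (Real.sqrt w)).indicator
            (fun a => B.indicator 1 (a / Real.sqrt w)) a := by
        intro a
        have : a ^ 2 < w ↔ a ∈ Set.Ioo (-Real.sqrt w) (Real.sqrt w) := by
          rw [Set.mem_Ioo, ← Real.sq_lt]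
        by_cases ha : a ∈ Set.Ioo (-Real.sqrt w) (Real.sqrt w)
        · rw [Set.indicator_of_mem ha, Set.indicator_of_mem (by exact this.2 ha)]
          simp only [Function.uncurry, F, Set.indicator_of_mem hw]
        · rw [Set.indicator_of_notMem ha, Set.indicator_of_notMem
            (show (a, w) ∉ {p : ℝ × ℝ | p.1 ^ 2 < p.2} from fun h => ha (this.1 h))]
      simp_rw [e2]
      have h3 := lintegral_intervalLaw_mul hs (g := fun a => B.indicator 1 (a / Real.sqrt w))
        ((measurable_one.indicator hB).comp (by fun_prop))
      rw [lintegral_indicator measurableSet_Ioo]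
      simp only [mul_div_cancel_left₀ _ hs.ne', lintegral_indicator_one hB] at h3
      rw [mul_left_comm, h3, ← mul_assoc, ENNReal.mul_inv_cancel two_ne_zero (by simp), one_mul]
    · rw [Set.indicator_of_notMem hw]
      have : ∀ a, {p : ℝ × ℝ | p.1 ^ 2 < p.2}.indicator (Function.uncurry F) (a, w) = 0 := by
        intro a
        refine Set.indicator_apply_eq_zero.2 fun _ => ?_
        simp only [Function.uncurry, F, Set.indicator_of_notMem hw]
      simp [this]
  -- the constant is determined by the total mass
  have h1 := key Set.univ MeasurableSet.univ
  have : IsProbabilityMeasure ((uniformSphere 3).map (fun x => x 0)) :=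
    Measure.isProbabilityMeasure_map hco.aemeasurable
  rw [measure_univ, measure_univ, mul_one] at h1
  ext B hB
  rw [key B hB]
  calc _ = K * (ENNReal.ofReal Real.pi * ((∫⁻ w in Set.Ioo (0 : ℝ) 1,
        ENNReal.ofReal (Real.sqrt w)) * 2)) * intervalLaw B := by ring
    _ = intervalLaw B := by rw [← h1, one_mul]

/-- A finite measure on `ℝ³` invariant under linear isometries is determined by the law of the first
coordinate. -/
lemma eq_of_map_coord_eq {μ ν : Measure (EuclideanSpace ℝ (Fin 3))} [IsFiniteMeasure μ]
    [IsFiniteMeasure ν]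
    (hμ : ∀ L : EuclideanSpace ℝ (Fin 3) ≃ₗᵢ[ℝ] EuclideanSpace ℝ (Fin 3), μ.map L = μ)
    (hν : ∀ L : EuclideanSpace ℝ (Fin 3) ≃ₗᵢ[ℝ] EuclideanSpace ℝ (Fin 3), ν.map L = ν)
    (h : μ.map (fun x => x 0) = ν.map (fun x => x 0)) : μ = ν := by
  refine Measure.ext_of_charFun (funext fun ξ => ?_)
  have hnorm : ‖‖ξ‖ • EuclideanSpace.single (0 : Fin 3) (1 : ℝ)‖ = ‖ξ‖ := by
    simp [norm_smul]
  set e : EuclideanSpace ℝ (Fin 3) := ‖ξ‖ • EuclideanSpace.single 0 1 with he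
  obtain ⟨L, hL⟩ : ∃ L : EuclideanSpace ℝ (Fin 3) ≃ₗᵢ[ℝ] EuclideanSpace ℝ (Fin 3), L e = ξ :=
    ⟨(Submodule.span ℝ {e - ξ})ᗮ.reflection, Submodule.reflection_sub hnorm⟩
  -- rotating `ξ` onto the first axis shows that the characteristic function is that of the projection
  have main : ∀ (m : Measure (EuclideanSpace ℝ (Fin 3))) [IsFiniteMeasure m], m.map L = m →
      charFun m ξ = charFun (m.map fun x => x 0) ‖ξ‖ := by
    intro m _ hm
    have hmeas : Measurable fun x : EuclideanSpace ℝ (Fin 3) => x 0 := by fun_prop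
    have hLm : Measurable L := L.continuous.measurable
    rw [charFun_apply, charFun_apply, integral_map hmeas.aemeasurable (by fun_prop), ← hm,
      integral_map hLm.aemeasurable (by fun_prop), hm]
    congr with x
    have : inner ℝ (L x) ξ = x 0 * ‖ξ‖ := by
      conv_lhs => rw [← hL]
      rw [L.inner_map_map, he, inner_smul_right]
      simp [EuclideanSpace.inner_single_right, mul_comm]
    rw [this]
    simp [mul_comm]
  rw [main μ (hμ L), main ν (hν L), h]

/-! ### The first coordinate of the Dirichlet flight -/

section

variable {Ω : Type*} [MeasurableSpace Ω] {P : Measure Ω} {r : ℝ}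

/-- The sum `τ` of two consecutive gaps has the `Gamma(2)` distribution, and given `τ` their
difference is uniformly distributed on `(-τ, τ)`. -/
lemma map_sum_sub_expMeasure_prod (hr : 0 < r) :
    ((expMeasure r).prod (expMeasure r)).map (fun q => (q.1 + q.2, q.1 - q.2))
      = ((gammaMeasure 2 r).prod intervalLaw).map (fun q => (q.1, q.1 * q.2)) := by
  have := isProbabilityMeasure_expMeasure hr
  have := isProbabilityMeasure_gammaMeasure (a := 2) (by positivity) hr
  refine Measure.ext_of_lintegral _ fun f hf => ?_
  have hm₁ : Measurable fun s => ∫⁻ s', f (s + s', s - s') ∂(expMeasure r) :=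
    Measurable.lintegral_prod_right' (f := fun p : ℝ × ℝ => f (p.1 + p.2, p.1 - p.2)) (by fun_prop)
  have hm₂ : Measurable fun z => ∫⁻ w, f (z, z * w) ∂intervalLaw :=
    Measurable.lintegral_prod_right' (f := fun p : ℝ × ℝ => f (p.1, p.1 * p.2)) (by fun_prop)
  rw [lintegral_map hf (by fun_prop), lintegral_map hf (by fun_prop),
    lintegral_prod _ (by fun_prop), lintegral_prod _ (by fun_prop),
    lintegral_expMeasure hm₁, lintegral_gammaMeasure_two hm₂]
  have h1 : ∀ s, ENNReal.ofReal (r * Real.exp (-(r * s))) *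
      ∫⁻ s', f (s + s', s - s') ∂(expMeasure r) = ∫⁻ s' in Set.Ioi 0,
        ENNReal.ofReal (r * Real.exp (-(r * s))) *
          (ENNReal.ofReal (r * Real.exp (-(r * (s + s' - s)))) *
            f (s + s', 2 * s - (s + s'))) := by
    intro s
    rw [lintegral_expMeasure (by fun_prop), ← lintegral_const_mul' _ _ ENNReal.ofReal_ne_top]
    refine lintegral_congr fun s' => ?_
    rw [add_sub_cancel_left, show 2 * s - (s + s') = s - s' by ring]
  simp_rw [h1]
  rw [lintegral_Ioi_Ioi_add (F := fun s z => ENNReal.ofReal (r * Real.exp (-(r * s))) *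
    (ENNReal.ofReal (r * Real.exp (-(r * (z - s)))) * f (z, 2 * s - z))) (by fun_prop)]
  refine setLIntegral_congr_fun measurableSet_Ioi fun z hz => ?_
  have hz' : 0 < z := hz
  have h2 : ∀ s, ENNReal.ofReal (r * Real.exp (-(r * s))) *
      (ENNReal.ofReal (r * Real.exp (-(r * (z - s)))) * f (z, 2 * s - z))
      = ENNReal.ofReal (r ^ 2 * Real.exp (-(r * z))) * f (z, 2 * s - z) := by
    intro s
    rw [← mul_assoc, ← ENNReal.ofReal_mul (by positivity)]
    congr 2
    have : Real.exp (-(r * z)) = Real.exp (-(r * s)) * Real.exp (-(r * (z - s))) := by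
      rw [← Real.exp_add]; congr 1; ring
    rw [this]; ring
  simp_rw [h2]
  rw [lintegral_const_mul' _ _ ENNReal.ofReal_ne_top,
    lintegral_intervalLaw_affine hz' (g := fun x => f (z, x)) (by fun_prop), ← mul_assoc,
    ← ENNReal.ofReal_mul (by positivity)]
  congr 2
  ring

lemma flightPos_apply_zero {n : ℕ} (c t : ℝ) (τ : Fin n → ℝ)
    (d : Fin (n + 1) → EuclideanSpace ℝ (Fin 3)) :
    flightPos c t (τ, d) 0 = c * ∑ j, allSteps t τ j * d j 0 := by
  simp [flightPos]

/-- For given step durations, the first coordinate is a sum of independent uniform displacements; the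
last of them is split off. -/
lemma lintegral_flightPos_apply_zero {n : ℕ} (c t : ℝ) (τ : Fin n → ℝ) {f : ℝ → ℝ≥0∞}
    (hf : Measurable f) :
    ∫⁻ d, f (flightPos c t (τ, d) 0) ∂(Measure.pi fun _ : Fin (n + 1) => uniformSphere 3)
      = ∫⁻ w, ∫⁻ u, f (c * (∑ k, τ k * w k + (t - ∑ k, τ k) * u)) ∂intervalLaw
        ∂(Measure.pi fun _ : Fin n => intervalLaw) := by
  have hmap : (Measure.pi fun _ : Fin (n + 1) => intervalLaw)
      = (Measure.pi fun _ : Fin (n + 1) => uniformSphere 3).map fun d j => d j 0 := by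
    have : IsProbabilityMeasure ((uniformSphere 3).map fun x => x 0) := by
      rw [map_coord_uniformSphere]; infer_instance
    rw [Measure.pi_map_pi (f := fun _ (x : EuclideanSpace ℝ (Fin 3)) => x 0)
      (fun _ => by fun_prop), map_coord_uniformSphere]
  have h1 : ∫⁻ d, f (flightPos c t (τ, d) 0) ∂(Measure.pi fun _ : Fin (n + 1) => uniformSphere 3)
      = ∫⁻ w, f (c * ∑ j, allSteps t τ j * w j)
        ∂(Measure.pi fun _ : Fin (n + 1) => intervalLaw) := by
    rw [hmap, lintegral_map (by fun_prop) (by fun_prop)]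
    simp_rw [flightPos_apply_zero]
  rw [h1, ← ((measurePreserving_piFinSuccAbove (fun _ => intervalLaw)
    (Fin.last n)).symm).lintegral_comp_emb (MeasurableEquiv.measurableEmbedding _),
    lintegral_prod_symm _ (by fun_prop)]
  refine lintegral_congr fun w => lintegral_congr fun u => ?_
  rw [Fin.sum_univ_castSucc]
  simp [allSteps, MeasurableEquiv.piFinSuccAbove, Fin.insertNthEquiv]

/-- The first coordinate of a flight with Dirichlet distributed steps has the law of a telegraph
process: by Archimedes' theorem, moving for a time `τ` in a random direction has the same effect
on it as moving forwards and backwards during the two gaps of which `τ` is the sum. -/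
lemma map_coord_dirichletFlightLaw [IsProbabilityMeasure P] (hr : 0 < r) {S : ℕ → Ω → ℝ}
    (hS : IsPoissonGaps P r S) {c t : ℝ} (hc : 0 < c) (ht : 0 < t) (n : ℕ) :
    (dirichletFlightLaw 3 n c t).map (fun x => x 0) = lineLaw n c t := by
  have := isProbabilityMeasure_expMeasure hr
  have := isProbabilityMeasure_gammaMeasure (a := 2) (by positivity) hr
  have : SFinite (dirichletLaw n t) := by unfold dirichletLaw; infer_instance
  refine Measure.ext_of_lintegral _ fun f hf => ?_
  have hPW0 := measure_window_ne_zero hr hS (2 * n + 1) ht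
  refine (ENNReal.mul_right_inj hPW0 (measure_ne_top _ _)).1 ?_
  have hm₀ : Measurable fun p : (Fin n → ℝ) × (Fin (n + 1) → EuclideanSpace ℝ (Fin 3)) =>
      f (flightPos c t p 0) :=
    hf.comp (Measurable.comp (g := fun x : EuclideanSpace ℝ (Fin 3) => x 0) (by fun_prop)
      (measurable_flightPos c t))
  -- `G (a, b)` is the contribution of the last step, `a` being the duration of the previous ones and
  -- `b` their contribution to the first coordinate
  set G : ℝ × ℝ → ℝ≥0∞ := fun p => ENNReal.ofReal (r * Real.exp (-(r * (t - p.1)))) *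
    ENNReal.ofReal (t - p.1) * ∫⁻ u, f (c * (p.2 + (t - p.1) * u)) ∂intervalLaw with hG
  have hGm : Measurable G := by
    refine Measurable.mul (by fun_prop) ?_
    exact Measurable.lintegral_prod_right'
      (f := fun p : (ℝ × ℝ) × ℝ => f (c * (p.1.2 + (t - p.1.1) * p.2))) (by fun_prop)
  have lhs : P (window S t (2 * n + 1)) * ∫⁻ x, f x ∂((dirichletFlightLaw 3 n c t).map fun x => x 0)
      = ∫⁻ q, G (∑ k, (q k).1, ∑ k, (q k).1 * (q k).2)
        ∂(Measure.pi fun _ : Fin n => (gammaMeasure 2 r).prod intervalLaw) := by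
    rw [lintegral_map hf (by fun_prop), dirichletFlightLaw_three,
      lintegral_map (by fun_prop) (measurable_flightPos c t), lintegral_prod _ hm₀.aemeasurable,
      measure_window hr hS _ ht.le, ← smul_eq_mul, ← lintegral_smul_measure,
      dirichletLaw_eq_withDensity hr ht]
    have hin : Measurable fun τ : Fin n → ℝ => ∫⁻ d, f (flightPos c t (τ, d) 0)
        ∂(Measure.pi fun _ : Fin (n + 1) => uniformSphere 3) := hm₀.lintegral_prod_right'
    have hG₂ : Measurable fun a : (Fin n → ℝ) × (Fin n → ℝ) =>
        G (∑ k, a.1 k, ∑ k, a.1 k * a.2 k) := hGm.comp (by fun_prop)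
    have hzip : ∫⁻ q, G (∑ k, (q k).1, ∑ k, (q k).1 * (q k).2)
        ∂(Measure.pi fun _ : Fin n => (gammaMeasure 2 r).prod intervalLaw)
        = ∫⁻ a, G (∑ k, a.1 k, ∑ k, a.1 k * a.2 k) ∂((Measure.pi fun _ : Fin n =>
          gammaMeasure 2 r).prod (Measure.pi fun _ => intervalLaw)) := by
      rw [← (measurePreserving_arrowProdEquivProdArrow ℝ ℝ (Fin n) (fun _ => gammaMeasure 2 r)
        fun _ => intervalLaw).lintegral_comp_emb (MeasurableEquiv.measurableEmbedding _)]
      rfl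
    rw [lintegral_withDensity_eq_lintegral_mul _ (by fun_prop) hin, hzip,
      lintegral_prod _ hG₂.aemeasurable]
    refine lintegral_congr fun τ => ?_
    rw [Pi.mul_apply, lintegral_flightPos_apply_zero c t τ hf, ← lintegral_const_mul' _ _
      (ENNReal.mul_ne_top ENNReal.ofReal_ne_top ENNReal.ofReal_ne_top)]
  have rhs : P (window S t (2 * n + 1)) * ∫⁻ x, f x ∂(lineLaw n c t)
      = ∫⁻ q, G (∑ k, ((q k).1 + (q k).2), ∑ k, ((q k).1 - (q k).2))
        ∂(Measure.pi fun _ : Fin n => (expMeasure r).prod (expMeasure r)) := by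
    have h := (hasLaw_alternating hr hS hc ht n).lintegral_comp hf.aemeasurable
    rw [lintegral_smul_measure, smul_eq_mul] at h
    rw [← h, window_eq_preimage_pairWindow]
    set H : (Fin n → ℝ × ℝ) → ℝ → ℝ≥0∞ := fun q s =>
      f (c * (∑ k, ((q k).1 - (q k).2) + (2 * s - (t - ∑ k, ((q k).1 + (q k).2))))) with hH
    have hHm : Measurable (Function.uncurry H) := by
      simp only [Function.uncurry_def, hH]
      fun_prop
    have e := setLIntegral_comp_of_hasLaw (hasLaw_pairs_last hr hS n)
      (measurableSet_pairWindow t n) (f := fun q => H q.2 q.1.1)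
      (hHm.comp (f := fun q : (ℝ × ℝ) × (Fin n → ℝ × ℝ) => (q.2, q.1.1)) (by fun_prop))
    have e' : ∀ ω, f (c * (2 * ∑ k ∈ Finset.range (n + 1), S (2 * k) ω - t))
        = H (fun k => (S (2 * k) ω, S (2 * k + 1) ω)) (S (2 * n) ω) := by
      intro ω
      simp only [hH]
      rw [Finset.sum_sub_distrib, Finset.sum_add_distrib, Finset.sum_range_succ,
        ← Finset.sum_range fun k => S (2 * k) ω]
      congr 2
      ring
    simp_rw [e']
    rw [e, lintegral_pairWindow hr t n hHm]
    refine lintegral_congr fun q => ?_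
    simp only [hG, hH]
    set R := t - ∑ k, ((q k).1 + (q k).2) with hR
    -- no time is left if `R ≤ 0`, and both sides vanish
    rcases le_or_gt R 0 with hR0 | hR0
    · rw [Set.Ioo_eq_empty (by simpa using hR0), ENNReal.ofReal_eq_zero.2 hR0]
      simp
    · rw [mul_assoc]
      congr 1
      exact lintegral_intervalLaw_affine hR0 (g := fun x =>
        f (c * (∑ k, ((q k).1 - (q k).2) + x))) (by fun_prop)
  -- both sides depend only on the law of (duration, displacement) of a single complete step
  have push : ∀ μ : Measure (ℝ × ℝ), IsProbabilityMeasure μ → ∀ φ : ℝ × ℝ → ℝ × ℝ, Measurable φ →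
      ∫⁻ q, G (∑ k, (φ (q k)).1, ∑ k, (φ (q k)).2) ∂(Measure.pi fun _ : Fin n => μ)
      = ∫⁻ q, G (∑ k, (q k).1, ∑ k, (q k).2) ∂(Measure.pi fun _ : Fin n => μ.map φ) := by
    intro μ _ φ hφ
    have := Measure.isProbabilityMeasure_map (μ := μ) hφ.aemeasurable
    rw [← Measure.pi_map_pi (fun _ => hφ.aemeasurable), lintegral_map (by fun_prop) (by fun_prop)]
  rw [lhs, rhs, push _ inferInstance (fun q => (q.1, q.1 * q.2)) (by fun_prop),
    push _ inferInstance (fun q => (q.1 + q.2, q.1 - q.2)) (by fun_prop),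
    map_sum_sub_expMeasure_prod hr]

lemma map_linearIsometryEquiv_dirichletFlightLaw (n : ℕ) (c t : ℝ)
    (L : EuclideanSpace ℝ (Fin 3) ≃ₗᵢ[ℝ] EuclideanSpace ℝ (Fin 3)) :
    (dirichletFlightLaw 3 n c t).map L = dirichletFlightLaw 3 n c t := by
  have hL : Measurable L := L.continuous.measurable
  have : SFinite (dirichletLaw n t) := by unfold dirichletLaw; infer_instance
  have : IsProbabilityMeasure ((uniformSphere 3).map L) :=
    Measure.isProbabilityMeasure_map hL.aemeasurable
  have hpi : (Measure.pi fun _ : Fin (n + 1) => uniformSphere 3).map (fun d j => L (d j))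
      = Measure.pi fun _ => uniformSphere 3 := by
    rw [Measure.pi_map_pi (fun _ => hL.aemeasurable), map_linearIsometryEquiv_uniformSphere]
  rw [dirichletFlightLaw_three, Measure.map_map hL (measurable_flightPos c t)]
  conv_rhs => rw [← hpi, ← Measure.map_id (μ := dirichletLaw n t),
    Measure.map_prod_map _ _ measurable_id (by fun_prop),
    Measure.map_map (measurable_flightPos c t) (by fun_prop)]
  congr 1
  ext1 p
  simp [flightPos]

end

/-! ### The density of the position -/

section

/-- For `n = 0` the truncated exponent `n - 1` of the left-hand side would differ from the real one. -/
lemma evenFlightDensity_eq_dirichletFlightDensity (n : ℕ) (hn : 1 ≤ n) (c t : ℝ) :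
    evenFlightDensity n c t = dirichletFlightDensity 3 n c t := by
  ext u
  unfold evenFlightDensity dirichletFlightDensity
  split_ifs with h
  · have e1 : ((n : ℝ) + 1) / 2 * (((3 : ℕ) : ℝ) - 1) + 1 / 2 = n + 3 / 2 := by
      push_cast; ring
    have e2 : (n : ℝ) / 2 * (((3 : ℕ) : ℝ) - 1) = n := by push_cast; ring
    have e3 : ((n : ℝ) + 1) * (((3 : ℕ) : ℝ) - 1) - 1 = ((2 * n + 1 : ℕ) : ℝ) := by
      push_cast; ring
    have e4 : (n : ℝ) - 1 = ((n - 1 : ℕ) : ℝ) := by push_cast [hn]; ring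
    rw [e1, e2, e3, e4, Real.rpow_natCast, Real.rpow_natCast]
    push_cast
    ring
  · rfl

lemma measurable_evenFlightDensity (n : ℕ) (c t : ℝ) : Measurable (evenFlightDensity n c t) := by
  unfold evenFlightDensity
  exact Measurable.ite (measurableSet_lt (by fun_prop) measurable_const) (by fun_prop)
    measurable_const

lemma map_linearIsometryEquiv_evenFlightDensity (n : ℕ) (c t : ℝ)
    (L : EuclideanSpace ℝ (Fin 3) ≃ₗᵢ[ℝ] EuclideanSpace ℝ (Fin 3)) :
    (volume.withDensity fun u => ENNReal.ofReal (evenFlightDensity n c t u)).map L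
      = volume.withDensity fun u => ENNReal.ofReal (evenFlightDensity n c t u) := by
  have hL : Measurable L := L.continuous.measurable
  have hd := (measurable_evenFlightDensity n c t).ennreal_ofReal
  refine Measure.ext_of_lintegral _ fun f hf => ?_
  rw [lintegral_map hf hL, lintegral_withDensity_eq_lintegral_mul _ hd (g := fun x => f (L x)) (hf.comp hL),
    lintegral_withDensity_eq_lintegral_mul _ hd hf,
    ← L.measurePreserving.lintegral_comp (hd.mul hf)]
  refine lintegral_congr fun u => ?_
  simp [evenFlightDensity]

lemma lintegral_Ioo_sub_pow (m : ℕ) {x : ℝ} (hx : 0 ≤ x) :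
    ∫⁻ y in Set.Ioo 0 x, ENNReal.ofReal ((x - y) ^ m) = ENNReal.ofReal (x ^ (m + 1) / (m + 1)) := by
  rw [← lintegral_Ioo_pow m hx, ← lintegral_indicator measurableSet_Ioo,
    ← lintegral_indicator measurableSet_Ioo, ← lintegral_sub_left_eq_self _ x]
  refine lintegral_congr fun y => ?_
  by_cases hy : y ∈ Set.Ioo 0 x
  · have : x - y ∈ Set.Ioo 0 x := ⟨by linarith [hy.2], by linarith [hy.1]⟩
    rw [Set.indicator_of_mem hy, Set.indicator_of_mem this, sub_sub_cancel]
  · have : x - y ∉ Set.Ioo 0 x := fun h => hy ⟨by linarith [h.2], by linarith [h.1]⟩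
    rw [Set.indicator_of_notMem hy, Set.indicator_of_notMem this]

/-- Integrating the three-dimensional density over the discs orthogonal to the first axis. -/
lemma map_coord_evenFlightDensity (m : ℕ) {c t : ℝ} (hc : 0 < c) (ht : 0 < t) :
    (volume.withDensity fun u => ENNReal.ofReal (evenFlightDensity (m + 1) c t u)).map
      (fun x => x 0) = lineLaw (m + 1) c t := by
  have hd := (measurable_evenFlightDensity (m + 1) c t).ennreal_ofReal
  have hco : Measurable fun x : EuclideanSpace ℝ (Fin 3) => x 0 := by fun_prop
  refine Measure.ext_of_lintegral _ fun f hf => ?_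
  rw [lintegral_map hf hco, lintegral_withDensity_eq_lintegral_mul _ hd (g := fun x => f (x 0)) (hf.comp hco),
    lintegral_lineLaw _ _ _ hf]
  set K : ℝ := Real.Gamma ((m + 1 : ℕ) + 3 / 2) / (Real.pi ^ (3 / 2 : ℝ) *
    Real.Gamma (m + 1 : ℕ) * (c * t) ^ (2 * (m + 1) + 1)) with hK
  have hK0 : 0 ≤ K := by
    have h1 : 0 < Real.Gamma ((m + 1 : ℕ) + 3 / 2) := Real.Gamma_pos_of_pos (by positivity)
    have h2 : 0 < Real.Gamma (m + 1 : ℕ) := Real.Gamma_pos_of_pos (by positivity)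
    positivity
  set F : ℝ → ℝ → ℝ≥0∞ := fun a w => (Set.Iio (c ^ 2 * t ^ 2)).indicator
    (fun w => ENNReal.ofReal (K * (c ^ 2 * t ^ 2 - w) ^ m)) w * f a with hFdef
  have hF : Measurable (Function.uncurry F) := by
    refine Measurable.mul ?_ (hf.comp measurable_fst)
    exact (Measurable.indicator (by fun_prop) measurableSet_Iio).comp measurable_snd
  have e : ∀ x : EuclideanSpace ℝ (Fin 3),
      ((fun u => ENNReal.ofReal (evenFlightDensity (m + 1) c t u)) *
        fun x : EuclideanSpace ℝ (Fin 3) => f (x 0)) x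
      = F (x 0) (‖x‖ ^ 2) := by
    intro x
    have hiff : ‖x‖ ^ 2 ∈ Set.Iio (c ^ 2 * t ^ 2) ↔ ‖x‖ < c * t := by
      rw [Set.mem_Iio, ← mul_pow]
      exact pow_lt_pow_iff_left₀ (norm_nonneg x) (by positivity) two_ne_zero
    simp only [Pi.mul_apply, F, evenFlightDensity]
    congr 1
    by_cases hx : ‖x‖ < c * t
    · rw [if_pos hx, Set.indicator_of_mem (hiff.2 hx), hK]
      rfl
    · rw [if_neg hx, Set.indicator_of_notMem (fun h => hx (hiff.1 h)), ENNReal.ofReal_zero]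
  simp_rw [e]
  rw [lintegral_fst_normSq hF, ← lintegral_const_mul' _ _ ENNReal.ofReal_ne_top]
  refine lintegral_congr fun a => ?_
  set ρ := c ^ 2 * t ^ 2 - a ^ 2 with hρ
  have hin : ∫⁻ v in Set.Ioi 0, F a (a ^ 2 + v)
      = (∫⁻ v in Set.Ioo 0 ρ, ENNReal.ofReal ((ρ - v) ^ m)) * (ENNReal.ofReal K * f a) := by
    rw [← lintegral_mul_const _ (by fun_prop), ← lintegral_indicator measurableSet_Ioi,
      ← lintegral_indicator measurableSet_Ioo]
    refine lintegral_congr fun v => ?_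
    by_cases h0 : 0 < v
    · rw [Set.indicator_of_mem (by exact h0)]
      by_cases h1 : v < ρ
      · rw [Set.indicator_of_mem (show v ∈ Set.Ioo 0 ρ from ⟨h0, h1⟩)]
        simp only [F]
        rw [Set.indicator_of_mem (by rw [Set.mem_Iio]; linarith), ENNReal.ofReal_mul hK0, hρ]
        ring_nf
      · rw [Set.indicator_of_notMem (fun h => h1 h.2)]
        simp only [F]
        rw [Set.indicator_of_notMem (by rw [Set.mem_Iio]; intro h; linarith), zero_mul]
    · rw [Set.indicator_of_notMem (by exact h0), Set.indicator_of_notMem (fun h => h0 h.1)]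
  rw [hin]
  have hiff : |a| < c * t ↔ 0 < ρ := by
    rw [hρ, sub_pos, ← mul_pow, sq_lt_sq, abs_of_pos (a := c * t) (by positivity)]
  by_cases ha : |a| < c * t
  · have hρ0 := hiff.1 ha
    rw [lintegral_Ioo_sub_pow m hρ0.le, lineDensity, if_pos ha, ← mul_assoc, ← mul_assoc,
      ← ENNReal.ofReal_mul Real.pi_pos.le, ← ENNReal.ofReal_mul (by positivity)]
    congr 2
    -- the constants agree by Legendre's duplication formula
    have hleg := Real.Gamma_mul_Gamma_add_half ((m + 1 : ℕ) + 1)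
    rw [show 2 * (((m + 1 : ℕ) : ℝ) + 1) = ((2 * (m + 1) + 1 : ℕ) : ℝ) + 1 by push_cast; ring,
      Real.Gamma_nat_eq_factorial, Real.Gamma_nat_eq_factorial,
      show 1 - (((2 * (m + 1) + 1 : ℕ) : ℝ) + 1) = -((2 * (m + 1) + 1 : ℕ) : ℝ) by ring,
      Real.rpow_neg two_pos.le, Real.rpow_natCast,
      show ((m + 1 : ℕ) : ℝ) + 1 + 1 / 2 = (m + 1 : ℕ) + 3 / 2 by ring] at hleg
    have hg : Real.Gamma ((m + 1 : ℕ) + 3 / 2) = (2 * (m + 1) + 1).factorial *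
        (2 ^ (2 * (m + 1) + 1))⁻¹ * Real.sqrt Real.pi / (m + 1).factorial := by
      rw [eq_div_iff (by positivity), mul_comm]
      exact hleg
    have hpi : Real.pi ^ (3 / 2 : ℝ) = Real.pi * Real.sqrt Real.pi := by
      rw [Real.sqrt_eq_rpow, ← Real.rpow_one_add' Real.pi_pos.le (by norm_num)]
      norm_num
    have hgm : Real.Gamma (m + 1 : ℕ) = m.factorial := by
      push_cast; exact Real.Gamma_nat_eq_factorial m
    rw [hK, hg, hpi, hgm, show (2 * c * t) = 2 * (c * t) by ring, mul_pow 2 (c * t),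
      Nat.factorial_succ m]
    have := Real.sqrt_pos.2 Real.pi_pos
    push_cast
    field_simp
    rw [hρ]
  · rw [Set.Ioo_eq_empty (fun h => ha (hiff.2 h)), lineDensity, if_neg ha]
    simp

variable {Ω : Type*} [MeasurableSpace Ω] {P : Measure Ω} {r : ℝ}

/-- The position has a density for `n ≥ 1`: both sides are invariant under linear isometries and
have the same projection to the first axis. -/
lemma dirichletFlightLaw_eq_withDensity [IsProbabilityMeasure P] (hr : 0 < r) {S : ℕ → Ω → ℝ}
    (hS : IsPoissonGaps P r S) {c t : ℝ} (hc : 0 < c) (ht : 0 < t) {n : ℕ} (hn : 1 ≤ n) :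
    dirichletFlightLaw 3 n c t
      = volume.withDensity fun u => ENNReal.ofReal (evenFlightDensity n c t u) := by
  obtain ⟨m, rfl⟩ : ∃ m, n = m + 1 := ⟨n - 1, by omega⟩
  have hco : Measurable fun x : EuclideanSpace ℝ (Fin 3) => x 0 := by fun_prop
  have h1 := map_coord_dirichletFlightLaw hr hS hc ht (m + 1)
  have h2 := map_coord_evenFlightDensity m hc ht
  have hprob : IsProbabilityMeasure (lineLaw (m + 1) c t) := by
    have := cond_isProbabilityMeasure (measure_window_ne_zero hr hS (2 * (m + 1) + 1) ht)
    exact (hasLaw_cond_of_restrict Filter.EventuallyEq.rfl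
      (measure_window_ne_zero hr hS _ ht)
      (hasLaw_alternating hr hS hc ht (m + 1))).isProbabilityMeasure_iff.1 this
  have : IsFiniteMeasure (dirichletFlightLaw 3 (m + 1) c t) := by
    rw [← h1] at hprob
    exact (Measure.isFiniteMeasure_map_iff hco.aemeasurable).1 inferInstance
  have : IsFiniteMeasure (volume.withDensity fun u : EuclideanSpace ℝ (Fin 3) =>
      ENNReal.ofReal (evenFlightDensity (m + 1) c t u)) := by
    rw [← h2] at hprob
    exact (Measure.isFiniteMeasure_map_iff hco.aemeasurable).1 inferInstance
  exact eq_of_map_coord_eq (map_linearIsometryEquiv_dirichletFlightLaw _ c t)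
    (map_linearIsometryEquiv_evenFlightDensity _ c t) (h1.trans h2.symm)

lemma hasLaw_evenFlight_coord [IsProbabilityMeasure P] (hr : 0 < r) {S : ℕ → Ω → ℝ}
    {D : ℕ → Ω → EuclideanSpace ℝ (Fin 3)} (hU : IsEvenFlight P r S D) {c t : ℝ} (hc : 0 < c)
    (ht : 0 < t) (n : ℕ) :
    HasLaw (fun ω => evenFlight c S D t ω 0) (P (window S t (2 * n + 1)) • lineLaw n c t)
      (P.restrict (window S t (2 * n + 1))) := by
  have hco : Measurable fun x : EuclideanSpace ℝ (Fin 3) => x 0 := by fun_prop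
  have h := hasLaw_evenFlight hr hU c ht n
  refine HasLaw.fun_comp (Y := fun x : EuclideanSpace ℝ (Fin 3) => x 0)
    ⟨hco.aemeasurable, ?_⟩ h
  rw [Measure.map_smul, map_coord_dirichletFlightLaw hr hU.gaps hc ht n]

end

end RandomFlight

theorem mainTheorem7 {Ω Ω' : Type*} [MeasurableSpace Ω] [MeasurableSpace Ω']
    (P : Measure Ω) [IsProbabilityMeasure P] (P' : Measure Ω') [IsProbabilityMeasure P']
    (r c t : ℝ) (hr : 0 < r) (hc : 0 < c) (ht : 0 < t)
    (S : ℕ → Ω → ℝ) (D : ℕ → Ω → EuclideanSpace ℝ (Fin 3))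
    (hU : RandomFlight.IsEvenFlight P r S D)
    (S' : ℕ → Ω' → ℝ) (V : Ω' → ℝ) (hT : RandomFlight.IsTelegraph P' r S' V) :
    -- the conditional law of the position, and its coincidence with the law of `X_3`
    (∀ n : ℕ, 1 ≤ n →
      HasLaw (RandomFlight.evenFlight c S D t)
        ((volume : Measure (EuclideanSpace ℝ (Fin 3))).withDensity
          (fun u => ENNReal.ofReal (RandomFlight.evenFlightDensity n c t u)))
        (cond P {ω | RandomFlight.eventCount S t ω = 2 * n + 1}) ∧
      RandomFlight.evenFlightDensity n c t = RandomFlight.dirichletFlightDensity 3 n c t ∧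
      HasLaw (RandomFlight.evenFlight c S D t) (RandomFlight.dirichletFlightLaw 3 n c t)
        (cond P {ω | RandomFlight.eventCount S t ω = 2 * n + 1})) ∧
    -- conditionally on `2n+1` events, the projection and the telegraph process have the same law
    (∀ n : ℕ,
      HasLaw (fun ω => RandomFlight.evenFlight c S D t ω 0)
        ((volume : Measure ℝ).withDensity
          (fun x => ENNReal.ofReal (RandomFlight.lineDensity n c t x)))
        (cond P {ω | RandomFlight.eventCount S t ω = 2 * n + 1}) ∧
      HasLaw (RandomFlight.telegraph c S' V t)
        ((volume : Measure ℝ).withDensity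
          (fun x => ENNReal.ofReal (RandomFlight.lineDensity n c t x)))
        (cond P' {ω | RandomFlight.eventCount S' t ω = 2 * n + 1})) ∧
    -- the same on the event that the number of Poisson events is odd
    HasLaw (fun ω => RandomFlight.evenFlight c S D t ω 0)
      ((volume : Measure ℝ).withDensity
        (fun x => ENNReal.ofReal (RandomFlight.oddLineDensity r c t x)))
      (P.restrict {ω | Odd (RandomFlight.eventCount S t ω)}) ∧
    HasLaw (RandomFlight.telegraph c S' V t)
      ((volume : Measure ℝ).withDensity
        (fun x => ENNReal.ofReal (RandomFlight.oddLineDensity r c t x)))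
      (P'.restrict {ω | Odd (RandomFlight.eventCount S' t ω)}) := by
  have hS := hU.gaps
  have hS' := hT.gaps
  have hcond := fun n : ℕ => RandomFlight.eventCount_ae_eq_window hr hS ht.le (m := 2 * n + 1)
    (by omega)
  have hcond' := fun n : ℕ => RandomFlight.eventCount_ae_eq_window hr hS' ht.le (m := 2 * n + 1)
    (by omega)
  have h0 := fun n : ℕ => RandomFlight.measure_window_ne_zero hr hS (2 * n + 1) ht
  have h0' := fun n : ℕ => RandomFlight.measure_window_ne_zero hr hS' (2 * n + 1) ht
  refine ⟨fun n hn => ?_, fun n => ⟨?_, ?_⟩, ?_, ?_⟩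
  · have h := RandomFlight.hasLaw_cond_of_restrict (hcond n) (h0 n)
      (RandomFlight.hasLaw_evenFlight hr hU c ht n)
    refine ⟨?_, RandomFlight.evenFlightDensity_eq_dirichletFlightDensity n hn c t, h⟩
    rwa [← RandomFlight.dirichletFlightLaw_eq_withDensity hr hS hc ht hn]
  · exact RandomFlight.hasLaw_cond_of_restrict (hcond n) (h0 n)
      (RandomFlight.hasLaw_evenFlight_coord hr hU hc ht n)
  · exact RandomFlight.hasLaw_cond_of_restrict (hcond' n) (h0' n)
      (RandomFlight.hasLaw_telegraph hr hT hc ht n)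
  · exact RandomFlight.hasLaw_restrict_odd hr hS hc ht
      fun n => RandomFlight.hasLaw_evenFlight_coord hr hU hc ht n
  · exact RandomFlight.hasLaw_restrict_odd hr hS' hc ht
      fun n => RandomFlight.hasLaw_telegraph hr hT hc ht n
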